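/- **Definitions.** Words are finite sequences of positive integers. *Weak $K$-Knuth equivalence* $\hat\equiv$ is the equivalence relation on words generated by the relations, for all words $\mathbf u,\mathbf v$ and all positive integers $a<b<c$: (1) $\mathbf u\,aa\,\mathbf v\sim \mathbf u\,a\,\mathbf v$; (2) $\mathbf u\,aba\,\mathbf v\sim\mathbf u\,bab\,\mathbf v$; (3) $\mathbf u\,bac\,\mathbf v\sim\mathbf u\,bca\,\mathbf v$; (4) $\mathbf u\,acb\,\mathbf v\sim\mathbf u\,cab\,\mathbf v$; (5) $ab\,\mathbf u\sim ba\,\mathbf u$. A word is *initial* if its set of letters is $[k]=\{1,\dots,k\}$ for some positive integer $k$. For an initial word $h$ let $[[h]]=\sum_{w\,\hat\equiv\,h}w$ (a formal infinite sum of words), and let $SKPR$ be the real vector space spanned by all the $[[h]]$ with $h$ initial. For initial words $h,h'$, where $h$ has largest letter $n$, put $$[[h]]\cdot[[h']]=\sum_{w\,\hat\equiv\,h,\ w'\,\hat\equiv\,h'} w \mathbin{\sqcup\!\sqcup} w'[n],$$ extended bilinearly, where $w'[n]$ is $w'$ with every letter increased by $n$ and $\mathbin{\sqcup\!\sqcup}$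 is the shuffle product (the sum of all shuffles, with multiplicity). For a word $w=w_1\cdots w_r$ let $\mathcal D(w)=\{i: w_i>w_{i+1}\}$ and $$f_{\mathcal D(w)}=\sum_{\substack{i_1\le\cdots\le i_r\\ i_j<i_{j+1}\text{ if }j\in\mathcal D(w)}}x_{i_1}\cdots x_{i_r}.$$ Let $\mathrm{QSym}$ be the algebra of real quasisymmetric formal power series in $x_1,x_2,\dots$ (series, possibly of unbounded degree, in which for all $i_1<\dots<i_k$, $j_1<\dots<j_k$ and exponents $a_1,\dots,a_k$ the coefficients of $x_{i_1}^{a_1}\cdots x_{i_k}^{a_k}$ and $x_{j_1}^{a_1}\cdots x_{j_k}^{a_k}$ agree). **Theorem.** The space $SKPR$ is closed under the product, and so is an associative (non-unital) real algebra. There is a unique linear map $\phi:SKPR\to\mathrm{QSym}$ with $$\phi([[h]])=\sum_{w\,\hat\equiv\,h}f_{\mathcal D(w)}$$ for every initial word $h$ (each monomial occurs in only finitely many terms of this sum), and $\phi$ is an algebra homomorphism: $\phi(xy)=\phi(x)\phi(y)$ for all $x,y\in SKPR$. -/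

import Mathlib

/-- Words in the positive integers. -/
abbrev Word : Type := List ℕ+

namespace Word

/-- The elementary weak K-Knuth moves. -/
inductive WeakKKnuthStep : Word → Word → Prop
  | idem (u v : Word) (a : ℕ+) :
      WeakKKnuthStep (u ++ [a, a] ++ v) (u ++ [a] ++ v)
  | braid (u v : Word) (a b : ℕ+) (hab : a < b) :
      WeakKKnuthStep (u ++ [a, b, a] ++ v) (u ++ [b, a, b] ++ v)
  | bac (u v : Word) (a b c : ℕ+) (hab : a < b) (hbc : b < c) :
      WeakKKnuthStep (u ++ [b, a, c] ++ v) (u ++ [b, c, a] ++ v)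
  | acb (u v : Word) (a b c : ℕ+) (hab : a < b) (hbc : b < c) :
      WeakKKnuthStep (u ++ [a, c, b] ++ v) (u ++ [c, a, b] ++ v)
  | swap (u : Word) (a b : ℕ+) (hab : a < b) :
      WeakKKnuthStep ([a, b] ++ u) ([b, a] ++ u)

/-- Weak K-Knuth equivalence of words. -/
def WeakKKnuth : Word → Word → Prop := Relation.EqvGen WeakKKnuthStep

/-- A word is initial if its set of letters is `{1, …, k}` for some positive integer `k`. -/
def IsInitial (h : Word) : Prop := ∃ k : ℕ+, ∀ a : ℕ+, a ∈ h ↔ a ≤ k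

/-- The largest letter of a word (`0` for the empty word). -/
def maxLetter : Word → ℕ
  | [] => 0
  | a :: w => max (a : ℕ) (maxLetter w)

/-- `a + n` as a positive integer. -/
def shiftLetter (n : ℕ) (a : ℕ+) : ℕ+ := ⟨(a : ℕ) + n, Nat.add_pos_left a.2 n⟩

/-- The word `w[n]`: every letter of `w` is increased by `n`. -/
def shift (n : ℕ) (w : Word) : Word := w.map (shiftLetter n)

/-- The shuffles of two words, with multiplicity. -/
def shuffle : Word → Word → Multiset Word
  | [], v => {v}
  | a :: u, [] => {a :: u}
  | a :: u, b :: v =>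
      (shuffle u (b :: v)).map (List.cons a) + (shuffle (a :: u) v).map (List.cons b)
termination_by u v => u.length + v.length

/-- The descent set `{i : w_i > w_{i+1}}`, with positions counted from `0`. -/
def descentSet (w : Word) : Set ℕ :=
  {i | ∃ h : i + 1 < w.length, w[i + 1] < w[i]}

/-! ### Auxiliary facts on shuffles -/

theorem shuffle_nil_right (u : Word) : shuffle u [] = {u} := by
  cases u <;> simp [shuffle]

theorem shuffle_nil_left (u : Word) : shuffle [] u = {u} := by
  simp [shuffle]

theorem shuffle_cons_cons (a b : ℕ+) (u v : Word) :
    shuffle (a :: u) (b :: v) =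
      (shuffle u (b :: v)).map (List.cons a) + (shuffle (a :: u) v).map (List.cons b) := by
  rw [shuffle]

theorem perm_of_mem_shuffle : ∀ (u v : Word) {w : Word}, w ∈ shuffle u v → w.Perm (u ++ v)
  | [], v, w, h => by
      rw [shuffle_nil_left, Multiset.mem_singleton] at h
      simp [h]
  | a :: u, [], w, h => by
      rw [shuffle_nil_right, Multiset.mem_singleton] at h
      simp [h]
  | a :: u, b :: v, w, h => by
      rw [shuffle_cons_cons, Multiset.mem_add, Multiset.mem_map, Multiset.mem_map] at h
      rcases h with ⟨x, hx, rfl⟩ | ⟨x, hx, rfl⟩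
      · exact (perm_of_mem_shuffle u (b :: v) hx).cons a
      · exact ((perm_of_mem_shuffle (a :: u) v hx).cons b).trans List.perm_middle.symm
termination_by u v => u.length + v.length

theorem shuffle_assoc : ∀ a b c : Word,
    (shuffle a b).bind (fun v => shuffle v c) = (shuffle b c).bind (fun v => shuffle a v)
  | [], b, c => by
      have : (shuffle b c).bind (fun v => ({v} : Multiset Word)) = shuffle b c := by
        rw [Multiset.bind_singleton, Multiset.map_id']
      simp [shuffle_nil_left, this]
  | x :: a, [], c => by simp [shuffle_nil_left, shuffle_nil_right]
  | x :: a, y :: b, [] => by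
      have : (shuffle (x :: a) (y :: b)).bind (fun v => ({v} : Multiset Word)) =
          shuffle (x :: a) (y :: b) := by
        rw [Multiset.bind_singleton, Multiset.map_id']
      simp [shuffle_nil_right, this]
  | x :: a, y :: b, z :: c => by
      have h1 := shuffle_assoc a (y :: b) (z :: c)
      have h2 := shuffle_assoc (x :: a) b (z :: c)
      have h3 := shuffle_assoc (x :: a) (y :: b) c
      rw [shuffle_cons_cons y z b c, Multiset.add_bind, Multiset.bind_map,
        Multiset.bind_map] at h1
      rw [shuffle_cons_cons x y a b, Multiset.add_bind, Multiset.bind_map,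
        Multiset.bind_map] at h3
      rw [shuffle_cons_cons x y a b, shuffle_cons_cons y z b c]
      simp only [Multiset.add_bind, Multiset.bind_map, shuffle_cons_cons, Multiset.bind_add,
        ← Multiset.map_bind]
      rw [h1, h2, ← h3]
      simp only [Multiset.map_add]
      abel
termination_by a b c => a.length + b.length + c.length

theorem coe_shiftLetter (n : ℕ) (a : ℕ+) : (shiftLetter n a : ℕ) = (a : ℕ) + n := rfl

theorem shiftLetter_injective (n : ℕ) : Function.Injective (shiftLetter n) := by
  intro a b h
  have := congrArg (fun x : ℕ+ => (x : ℕ)) h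
  simp only [coe_shiftLetter] at this
  exact PNat.eq (by omega)

theorem shift_injective (n : ℕ) : Function.Injective (shift n) :=
  List.map_injective_iff.mpr (shiftLetter_injective n)

theorem shift_shift (m n : ℕ) (w : Word) : shift m (shift n w) = shift (m + n) w := by
  simp only [shift, List.map_map]
  congr 1
  funext a
  apply PNat.eq
  simp only [Function.comp, coe_shiftLetter]
  omega

theorem shuffle_shift (n : ℕ) : ∀ u v : Word,
    shuffle (shift n u) (shift n v) = (shuffle u v).map (shift n)
  | [], v => by simp [shift, shuffle_nil_left]
  | a :: u, [] => by simp [shift, shuffle_nil_right]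
  | a :: u, b :: v => by
      have h1 := shuffle_shift n u (b :: v)
      have h2 := shuffle_shift n (a :: u) v
      simp only [shift, List.map_cons] at h1 h2 ⊢
      rw [shuffle_cons_cons, shuffle_cons_cons, h1, h2]
      simp only [Multiset.map_add, Multiset.map_map]
      rfl
termination_by u v => u.length + v.length

theorem maxLetter_le_iff (w : Word) (n : ℕ) : maxLetter w ≤ n ↔ ∀ a ∈ w, (a : ℕ) ≤ n := by
  induction w with
  | nil => simp [maxLetter]
  | cons a w ih => simp [maxLetter, ih]

theorem maxLetter_le_shift (n : ℕ) (w : Word) : maxLetter w ≤ maxLetter (shift n w) := by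
  rw [maxLetter_le_iff]
  intro a ha
  have := (maxLetter_le_iff (shift n w) _).1 le_rfl (shiftLetter n a) (List.mem_map_of_mem ha)
  simp only [coe_shiftLetter] at this
  omega

theorem maxLetter_shuffle {u v w : Word} (h : w ∈ shuffle u v) :
    maxLetter w = max (maxLetter u) (maxLetter v) := by
  refine eq_of_forall_ge_iff fun n => ?_
  have hp := perm_of_mem_shuffle u v h
  rw [max_le_iff, maxLetter_le_iff, maxLetter_le_iff, maxLetter_le_iff]
  simp only [hp.mem_iff, List.mem_append]
  constructor
  · intro H
    exact ⟨fun a ha => H a (Or.inl ha), fun a ha => H a (Or.inr ha)⟩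
  · rintro ⟨H1, H2⟩ a (ha | ha)
    · exact H1 a ha
    · exact H2 a ha

theorem max_maxLetter_shift (n : ℕ) (w : Word) :
    max n (maxLetter (shift n w)) = n + maxLetter w := by
  induction w with
  | nil => simp [shift, maxLetter]
  | cons a w ih =>
      simp only [shift, List.map_cons, maxLetter, coe_shiftLetter] at ih ⊢
      omega

end Word

/-- Formal, possibly infinite, real linear combinations of words. -/
def WordSeries : Type := Word → ℝ

namespace WordSeries

open Word

noncomputable instance : AddCommGroup WordSeries := inferInstanceAs (AddCommGroup (Word → ℝ))

noncomputable instance : Module ℝ WordSeries := inferInstanceAs (Module ℝ (Word → ℝ))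

@[ext] theorem ext {F G : WordSeries} (h : ∀ u, F u = G u) : F = G := funext h

/-- The multiplicity of `u` in the shifted shuffle of `w` and `w'[n]`, `n` the largest letter
of `w`. -/
def shuffleCoeff (w w' u : Word) : ℕ := (shuffle w (shift (maxLetter w) w')).count u

/-- The bilinear extension to formal sums of words of
`(w, w') ↦ w ⧢ w'[n]`, where `n` is the largest letter of `w`. For a fixed word `u` only
finitely many pairs `(w, w')` contribute. -/
noncomputable instance : Mul WordSeries where
  mul F G := fun u => ∑ᶠ p : Word × Word, F p.1 * G p.2 * (shuffleCoeff p.1 p.2 u : ℝ)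

theorem mul_apply (F G : WordSeries) (u : Word) :
    (F * G) u = ∑ᶠ p : Word × Word, F p.1 * G p.2 * (shuffleCoeff p.1 p.2 u : ℝ) := rfl

/-- Words of length at most `L` with letters at most `M`. -/
def boundedWords (L M : ℕ) : Set Word := {w | w.length ≤ L ∧ maxLetter w ≤ M}

theorem boundedWords_finite (L M : ℕ) : (boundedWords L M).Finite := by
  have hA : {a : ℕ+ | (a : ℕ) ≤ M}.Finite :=
    (Set.finite_Iic M).preimage (PNat.coe_injective.injOn)
  have : Finite {a : ℕ+ | (a : ℕ) ≤ M} := hA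
  have hf := List.finite_length_le {a : ℕ+ | (a : ℕ) ≤ M} L
  refine (hf.image (List.map Subtype.val)).subset ?_
  rintro w ⟨h1, h2⟩
  rw [maxLetter_le_iff] at h2
  refine ⟨w.attach.map (fun a => ⟨a.1, h2 a.1 a.2⟩), ?_, ?_⟩
  · change List.length _ ≤ L
    simpa using h1
  · simp [List.map_map, Function.comp_def]

theorem mem_bounded_of_ne {w w' u : Word} {L M : ℕ} (hu : u ∈ boundedWords L M)
    (h : shuffleCoeff w w' u ≠ 0) : w ∈ boundedWords L M ∧ w' ∈ boundedWords L M := by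
  have hm : u ∈ shuffle w (shift (maxLetter w) w') := Multiset.count_ne_zero.1 h
  have hp := (perm_of_mem_shuffle _ _ hm).length_eq
  have hx := maxLetter_shuffle hm
  have hs := maxLetter_le_shift (maxLetter w) w'
  have hl : (shift (maxLetter w) w').length = w'.length := by simp [shift]
  obtain ⟨h1, h2⟩ := hu
  rw [List.length_append] at hp
  exact ⟨⟨by omega, by omega⟩, ⟨by omega, by omega⟩⟩

theorem support_subset (F G : WordSeries) {u : Word} {L M : ℕ} (hu : u ∈ boundedWords L M) :
    Function.support (fun p : Word × Word => F p.1 * G p.2 * (shuffleCoeff p.1 p.2 u : ℝ)) ⊆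
      ((boundedWords_finite L M).toFinset ×ˢ (boundedWords_finite L M).toFinset :
        Finset (Word × Word)) := by
  intro p hp
  have : shuffleCoeff p.1 p.2 u ≠ 0 := by
    intro h
    apply hp
    simp [h]
  simpa using mem_bounded_of_ne hu this

theorem mul_apply_eq_sum (F G : WordSeries) {u : Word} {L M : ℕ} (hu : u ∈ boundedWords L M) :
    (F * G) u = ∑ w ∈ (boundedWords_finite L M).toFinset,
      ∑ w' ∈ (boundedWords_finite L M).toFinset, F w * G w' * (shuffleCoeff w w' u : ℝ) := by
  rw [mul_apply, finsum_eq_sum_of_support_subset _ (support_subset F G hu),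
    Finset.sum_product]

theorem self_mem_boundedWords (u : Word) : u ∈ boundedWords u.length (maxLetter u) :=
  ⟨le_rfl, le_rfl⟩

theorem bind_shuffle_eq (a b c : Word) :
    (shuffle a (shift (maxLetter a) b)).bind (fun v => shuffle v (shift (maxLetter v) c)) =
      (shuffle b (shift (maxLetter b) c)).bind
        (fun v => shuffle a (shift (maxLetter a) v)) := by
  have h1 : (shuffle a (shift (maxLetter a) b)).bind
      (fun v => shuffle v (shift (maxLetter v) c)) =
      (shuffle a (shift (maxLetter a) b)).bind
        (fun v => shuffle v (shift (maxLetter a + maxLetter b) c)) := by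
    refine Multiset.bind_congr fun v hv => ?_
    rw [maxLetter_shuffle hv, max_maxLetter_shift]
  rw [h1, shuffle_assoc, ← shift_shift, shuffle_shift, Multiset.bind_map]

theorem sum_shuffleCoeff {S : Finset Word} {m : Multiset Word} {g : Word → ℕ}
    (h : ∀ v, m.count v * g v ≠ 0 → v ∈ S) :
    ∑ v ∈ S, m.count v * g v = (m.map g).sum := by
  rw [Finset.sum_multiset_map_count]
  simp only [smul_eq_mul]
  have h2 : ∑ v ∈ S, m.count v * g v = ∑ v ∈ S ∪ m.toFinset, m.count v * g v := by
    refine Finset.sum_subset Finset.subset_union_left fun v _ hv => ?_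
    by_contra h'
    exact hv (h v h')
  rw [h2]
  symm
  refine Finset.sum_subset Finset.subset_union_right fun v _ hv => ?_
  rw [Multiset.mem_toFinset] at hv
  simp [Multiset.count_eq_zero_of_notMem hv]

theorem shuffleCoeff_assoc (a b c u : Word) {L M : ℕ} (hu : u ∈ boundedWords L M) :
    ∑ v ∈ (boundedWords_finite L M).toFinset, shuffleCoeff a b v * shuffleCoeff v c u =
      ∑ v ∈ (boundedWords_finite L M).toFinset, shuffleCoeff b c v * shuffleCoeff a v u := by
  have key := congrArg (Multiset.count u) (bind_shuffle_eq a b c)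
  rw [Multiset.count_bind, Multiset.count_bind] at key
  have e1 := sum_shuffleCoeff (S := (boundedWords_finite L M).toFinset)
    (m := shuffle a (shift (maxLetter a) b)) (g := fun v => shuffleCoeff v c u) (by
      intro v hv
      simpa using (mem_bounded_of_ne hu (right_ne_zero_of_mul hv)).1)
  have e2 := sum_shuffleCoeff (S := (boundedWords_finite L M).toFinset)
    (m := shuffle b (shift (maxLetter b) c)) (g := fun v => shuffleCoeff a v u) (by
      intro v hv
      simpa using (mem_bounded_of_ne hu (right_ne_zero_of_mul hv)).2)
  exact e1.trans (key.trans e2.symm)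

/-- With the shifted shuffle product, formal sums of words form an associative ring. -/
noncomputable instance : NonUnitalRing WordSeries where
  left_distrib F G H := by
    ext u
    change (F * (G + H)) u = (F * G) u + (F * H) u
    simp only [mul_apply_eq_sum _ _ (self_mem_boundedWords u), ← Finset.sum_add_distrib]
    refine Finset.sum_congr rfl fun w _ => Finset.sum_congr rfl fun w' _ => ?_
    change F w * (G w' + H w') * _ = _
    ring
  right_distrib F G H := by
    ext u
    change ((F + G) * H) u = (F * H) u + (G * H) u
    simp only [mul_apply_eq_sum _ _ (self_mem_boundedWords u), ← Finset.sum_add_distrib]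
    refine Finset.sum_congr rfl fun w _ => Finset.sum_congr rfl fun w' _ => ?_
    change (F w + G w) * H w' * _ = _
    ring
  zero_mul F := by
    ext u
    rw [mul_apply]
    change (∑ᶠ p : Word × Word, (0 : ℝ) * _ * _) = (0 : ℝ)
    simp
  mul_zero F := by
    ext u
    rw [mul_apply]
    change (∑ᶠ p : Word × Word, _ * (0 : ℝ) * _) = (0 : ℝ)
    simp
  mul_assoc F G H := by
    ext u
    have hu := self_mem_boundedWords u
    set S := (boundedWords_finite u.length (maxLetter u)).toFinset with hS
    have hl : (F * G * H) u = ∑ a ∈ S, ∑ b ∈ S, ∑ c ∈ S, F a * G b * H c *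
        ((∑ v ∈ S, shuffleCoeff a b v * shuffleCoeff v c u : ℕ) : ℝ) := by
      have h0 : (F * G * H) u = ∑ v ∈ S, ∑ c ∈ S, ∑ a ∈ S, ∑ b ∈ S,
          F a * G b * H c * ((shuffleCoeff a b v : ℝ) * (shuffleCoeff v c u : ℝ)) := by
        rw [mul_apply_eq_sum _ _ hu]
        refine Finset.sum_congr rfl fun v hv => Finset.sum_congr rfl fun c _ => ?_
        rw [mul_apply_eq_sum F G (by simpa [hS] using hv), Finset.sum_mul, Finset.sum_mul]
        refine Finset.sum_congr rfl fun a _ => ?_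
        rw [Finset.sum_mul, Finset.sum_mul]
        refine Finset.sum_congr rfl fun b _ => ?_
        ring
      rw [h0, Finset.sum_congr rfl fun v _ => Finset.sum_comm, Finset.sum_comm]
      refine Finset.sum_congr rfl fun a _ => ?_
      rw [Finset.sum_congr rfl fun v _ => Finset.sum_comm, Finset.sum_comm]
      refine Finset.sum_congr rfl fun b _ => ?_
      rw [Finset.sum_comm]
      refine Finset.sum_congr rfl fun c _ => ?_
      push_cast
      rw [Finset.mul_sum]
    have hr : (F * (G * H)) u = ∑ a ∈ S, ∑ b ∈ S, ∑ c ∈ S, F a * G b * H c *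
        ((∑ v ∈ S, shuffleCoeff b c v * shuffleCoeff a v u : ℕ) : ℝ) := by
      have h0 : (F * (G * H)) u = ∑ a ∈ S, ∑ v ∈ S, ∑ b ∈ S, ∑ c ∈ S,
          F a * G b * H c * ((shuffleCoeff b c v : ℝ) * (shuffleCoeff a v u : ℝ)) := by
        rw [mul_apply_eq_sum _ _ hu]
        refine Finset.sum_congr rfl fun a _ => Finset.sum_congr rfl fun v hv => ?_
        rw [mul_apply_eq_sum G H (by simpa [hS] using hv), Finset.mul_sum, Finset.sum_mul]
        refine Finset.sum_congr rfl fun b _ => ?_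
        rw [Finset.mul_sum, Finset.sum_mul]
        refine Finset.sum_congr rfl fun c _ => ?_
        ring
      rw [h0]
      refine Finset.sum_congr rfl fun a _ => ?_
      rw [Finset.sum_comm]
      refine Finset.sum_congr rfl fun b _ => ?_
      rw [Finset.sum_comm]
      refine Finset.sum_congr rfl fun c _ => ?_
      push_cast
      rw [Finset.mul_sum]
    rw [hl, hr]
    refine Finset.sum_congr rfl fun a _ => Finset.sum_congr rfl fun b _ =>
      Finset.sum_congr rfl fun c _ => ?_
    rw [shuffleCoeff_assoc a b c u hu]

instance : IsScalarTower ℝ WordSeries WordSeries where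
  smul_assoc r F G := by
    ext u
    change ((r • F) * G) u = r * (F * G) u
    simp only [mul_apply_eq_sum _ _ (self_mem_boundedWords u), Finset.mul_sum]
    refine Finset.sum_congr rfl fun w _ => Finset.sum_congr rfl fun w' _ => ?_
    change (r * F w) * G w' * _ = _
    ring

instance : SMulCommClass ℝ WordSeries WordSeries where
  smul_comm r F G := by
    ext u
    change r * (F * G) u = (F * (r • G)) u
    simp only [mul_apply_eq_sum _ _ (self_mem_boundedWords u), Finset.mul_sum]
    refine Finset.sum_congr rfl fun w _ => Finset.sum_congr rfl fun w' _ => ?_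
    change _ = F w * (r * G w') * _
    ring

open Classical in
/-- `[[h]]`: the formal sum of all words in the weak K-Knuth class of `h`. -/
noncomputable def wordClass (h : Word) : WordSeries := fun w => if WeakKKnuth h w then 1 else 0

end WordSeries

/-- The real vector space spanned by the sums `[[h]]`, `h` an initial word. -/
noncomputable def SKPR : Submodule ℝ WordSeries :=
  Submodule.span ℝ {F | ∃ h : Word, Word.IsInitial h ∧ F = WordSeries.wordClass h}

/-- A power series in `x_1, x_2, …` is quasisymmetric if for all `i_1 < ⋯ < i_k`,
`j_1 < ⋯ < j_k` and all exponents `a_1, …, a_k` the coefficients of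
`x_{i_1}^{a_1} ⋯ x_{i_k}^{a_k}` and `x_{j_1}^{a_1} ⋯ x_{j_k}^{a_k}` agree. -/
def IsQuasisymmetric (F : MvPowerSeries ℕ+ ℝ) : Prop :=
  ∀ (k : ℕ) (i j : Fin k ↪o ℕ+) (a : Fin k →₀ ℕ),
    MvPowerSeries.coeff (a.embDomain i.toEmbedding) F =
      MvPowerSeries.coeff (a.embDomain j.toEmbedding) F

theorem coeff_embDomain_mul (F G : MvPowerSeries ℕ+ ℝ) {k : ℕ} (i : Fin k ↪o ℕ+)
    (a : Fin k →₀ ℕ) :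
    MvPowerSeries.coeff (a.embDomain i.toEmbedding) (F * G) =
      ∑ p ∈ Finset.HasAntidiagonal.antidiagonal a, MvPowerSeries.coeff (p.1.embDomain i.toEmbedding) F *
        MvPowerSeries.coeff (p.2.embDomain i.toEmbedding) G := by
  classical
  rw [MvPowerSeries.coeff_mul]
  symm
  refine Finset.sum_bij
    (fun p _ => (p.1.embDomain i.toEmbedding, p.2.embDomain i.toEmbedding)) ?_ ?_ ?_ ?_
  · intro p hp
    rw [Finset.HasAntidiagonal.mem_antidiagonal] at hp ⊢
    rw [← hp]
    exact (Finsupp.embDomain_add _ _ _).symm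
  · intro p _ q _ h
    rw [Prod.mk.injEq] at h
    exact Prod.ext (Finsupp.embDomain_injective _ h.1) (Finsupp.embDomain_injective _ h.2)
  · rintro ⟨x, y⟩ h
    rw [Finset.HasAntidiagonal.mem_antidiagonal] at h
    have hz : ∀ t : ℕ+, t ∉ Set.range i → x t = 0 ∧ y t = 0 := by
      intro t ht
      have h1 : x t + y t = 0 := by
        have h2 := DFunLike.congr_fun h t
        rw [Finsupp.embDomain_of_notMem_range _ _ _ ht] at h2
        exact h2
      omega
    have hx : ∀ z : ℕ+ →₀ ℕ, (∀ t : ℕ+, t ∉ Set.range i → z t = 0) →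
        (z.comapDomain i i.injective.injOn).embDomain i.toEmbedding = z := by
      intro z hz
      ext t
      by_cases ht : t ∈ Set.range i
      · obtain ⟨s, rfl⟩ := ht
        exact Finsupp.embDomain_apply_self i.toEmbedding _ s
      · rw [hz t ht]
        exact Finsupp.embDomain_of_notMem_range _ _ _ ht
    refine ⟨(x.comapDomain i i.injective.injOn, y.comapDomain i i.injective.injOn), ?_, ?_⟩
    · rw [Finset.HasAntidiagonal.mem_antidiagonal]
      ext s
      have h2 := DFunLike.congr_fun h (i s)
      exact h2.trans (Finsupp.embDomain_apply_self i.toEmbedding a s)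
    · exact Prod.ext (hx x fun t ht => (hz t ht).1) (hx y fun t ht => (hz t ht).2)
  · intro p _
    rfl

/-- The algebra of real quasisymmetric functions, as power series in `x_1, x_2, …`; the degree
is not required to be bounded, so that infinite sums of fundamental quasisymmetric functions
of increasing degree are allowed. -/
noncomputable def QSym : Subalgebra ℝ (MvPowerSeries ℕ+ ℝ) where
  carrier := {F | IsQuasisymmetric F}
  mul_mem' := by
    intro F G hF hG k i j a
    rw [coeff_embDomain_mul, coeff_embDomain_mul]
    exact Finset.sum_congr rfl fun p _ => by rw [hF k i j p.1, hG k i j p.2]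
  add_mem' := by
    intro F G hF hG k i j a
    rw [map_add, map_add, hF k i j a, hG k i j a]
  algebraMap_mem' := by
    classical
    intro r k i j a
    rw [MvPowerSeries.algebraMap_apply, MvPowerSeries.coeff_C, MvPowerSeries.coeff_C]
    simp [Finsupp.embDomain_eq_zero]

/-- The fundamental quasisymmetric function `f_D` of degree `n`: the sum of the monomials
`x_{s_1} ⋯ x_{s_n}` over all sequences `s_1 ≤ ⋯ ≤ s_n` of positive integers that increase
strictly at the positions in `D` (counted from `0`). -/
noncomputable def fundamental (n : ℕ) (D : Set ℕ) : MvPowerSeries ℕ+ ℝ := fun m =>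
  (Set.ncard {s : Fin n → ℕ+ | Monotone s ∧
    (∀ (j : ℕ) (hj : j + 1 < n), j ∈ D → s ⟨j, by omega⟩ < s ⟨j + 1, hj⟩) ∧
    ∑ t, Finsupp.single (s t) 1 = m} : ℝ)

/-- `f_{D(w)}`. -/
noncomputable def fundamentalOfWord (w : Word) : MvPowerSeries ℕ+ ℝ :=
  fundamental w.length (Word.descentSet w)

/-- `F` is the formal sum of the family `f`: every monomial occurs in only finitely many
members, and the coefficients of `F` are the sums of their coefficients. -/
def HasFormalSum {ι : Type*} (f : ι → MvPowerSeries ℕ+ ℝ) (F : MvPowerSeries ℕ+ ℝ) : Prop :=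
  ∀ m : ℕ+ →₀ ℕ, {i | MvPowerSeries.coeff m (f i) ≠ 0}.Finite ∧
    MvPowerSeries.coeff m F = ∑ᶠ i, MvPowerSeries.coeff m (f i)

/-!
If all letters of `w` are at most `n`, a word `u` is a shuffle of `w` and `w'[n]` exactly when `w`
is its subword of letters at most `n` and `w'[n]` its subword of letters larger than `n`; the
multiplicity is then one. Restriction to an interval of letters preserves weak K-Knuth equivalence,
so the coefficients of `[[h]] · [[h']]` are constant on equivalence classes. This product is a
*finite* combination of classes because there are only finitely many of them on a bounded alphabet.
Indeed, consider a monoid generated by elements `x_a` subject to the K-Knuth relations, and let `N`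
be the largest letter. For every word `v` in smaller letters, `x_N v x_N` lies in the double coset
of `x_N` modulo the submonoid generated by the smaller letters; hence the whole monoid is the union
of that submonoid and of this double coset, and is finite by induction on the alphabet.

For the map to quasisymmetric functions, arrange the index sequence of a term of `f_{D(w)}` above
the word `w`: the inequalities imposed at the descents say that the columns increase
lexicographically. Thus the coefficient of `f_{D(w)}` at a monomial counts the multisets of columns
with that monomial as top row and `w` as bottom row. Splitting such a multiset according to whether
the bottom entry is at most `n` turns the product of `f_{D(w)}` and `f_{D(w'[n])}` into the sum over
the shuffles of `w` and `w'[n]`, and `w'` and `w'[n]` have the same descents.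
-/

section KKnuthMonoid

theorem exists_list_of_mem_closure_image {α M : Type*} [Monoid M] {x : α → M} {s : Set α} {y : M}
    (hy : y ∈ Submonoid.closure (x '' s)) :
    ∃ w : List α, (∀ a ∈ w, a ∈ s) ∧ (w.map x).prod = y := by
  induction hy using Submonoid.closure_induction_left with
  | one => exact ⟨[], by simp⟩
  | mul_left y hy z _ ih =>
    obtain ⟨a, ha, rfl⟩ := hy
    obtain ⟨w, hw, rfl⟩ := ih
    exact ⟨a :: w, by simpa [ha] using hw, by simp⟩

variable {α M : Type*} [LinearOrder α] [Monoid M]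

/-- The K-Knuth relations among elements `x a` of a monoid indexed by a linear order. They are the
weak K-Knuth moves without the move that swaps the first two letters of a word. -/
structure KKnuthRelations (x : α → M) : Prop where
  idem (a : α) : x a * x a = x a
  braid {a b : α} (hab : a < b) : x a * x b * x a = x b * x a * x b
  bac {a b c : α} (hab : a < b) (hbc : b < c) : x b * x a * x c = x b * x c * x a
  acb {a b c : α} (hab : a < b) (hbc : b < c) : x a * x c * x b = x c * x a * x b

namespace KKnuthRelations

variable {x : α → M}

theorem exists_ascent_mul (hx : KKnuthRelations x) {a c y : α} (hac : a < c) (hay : a < y) :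
    ∃ a' ∈ [c, a, y], ∃ y' ∈ [c, a, y], ∃ z ∈ [c, a, y],
      a' < y' ∧ x a' * x y' * x z = x c * x a * x y := by
  rcases lt_trichotomy y c with hyc | rfl | hcy
  · exact ⟨a, by simp, c, by simp, y, by simp, hac, hx.acb hay hyc⟩
  · exact ⟨a, by simp, y, by simp, a, by simp, hay, hx.braid hay⟩
  · exact ⟨c, by simp, y, by simp, a, by simp, hcy, (hx.bac hac hcy).symm⟩

theorem pairwise_gt_or_exists_shorter_or_ascent (hx : KKnuthRelations x) (w : List α) :
    w.Pairwise (· > ·) ∨ ∃ w' ⊆ w, (w'.map x).prod = (w.map x).prod ∧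
      (w'.length < w.length ∨
        w'.length ≤ w.length ∧ ∃ a b t, w' = a :: b :: t ∧ a < b) := by
  induction w with
  | nil => exact .inl .nil
  | cons c w ih =>
    rcases ih with hw | ⟨w', hsub, hprod, hshort | ⟨hlen, a, b, t, rfl, hab⟩⟩
    · cases w with
      | nil => exact .inl (List.pairwise_singleton _ c)
      | cons d t =>
        rcases lt_trichotomy c d with hcd | rfl | hdc
        · exact .inr ⟨c :: d :: t, fun _ h => h, rfl, .inr ⟨le_rfl, c, d, t, rfl, hcd⟩⟩
        · exact .inr ⟨c :: t, by simp, by simp [← mul_assoc, hx.idem], .inl (by simp)⟩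
        · exact .inl (List.pairwise_cons_cons_iff_of_trans.2 ⟨hdc, hw⟩)
    · exact .inr ⟨c :: w', List.cons_subset_cons c hsub, by simp [hprod], .inl (by simpa)⟩
    · have hle := Nat.succ_le_succ hlen
      simp only [List.map_cons, List.prod_cons] at hprod
      rcases lt_trichotomy c a with hca | rfl | hac
      · exact .inr ⟨c :: a :: b :: t, List.cons_subset_cons c hsub, by simp [← hprod],
          .inr ⟨hle, c, a, b :: t, rfl, hca⟩⟩
      · exact .inr ⟨c :: b :: t, fun _ h => .tail _ (hsub h),
          by simp [← hprod, ← mul_assoc, hx.idem], .inl hle⟩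
      · obtain ⟨a', ha', b', hb', z, hz, hab', heq⟩ := hx.exists_ascent_mul hac hab
        refine .inr ⟨a' :: b' :: z :: t, ?_, ?_, .inr ⟨hle, a', b', z :: t, rfl, hab'⟩⟩
        · have hcab : [c, a, b] ⊆ c :: w := List.cons_subset_cons c fun _ h => hsub (by grind)
          have ht : t ⊆ c :: w := fun _ h => .tail _ (hsub (by simp [h]))
          simp [hcab ha', hcab hb', hcab hz, ht]
        · simp only [List.map_cons, List.prod_cons, ← hprod, ← mul_assoc, heq]

theorem mul_prod_mul_mem_doubleCoset_of_pairwise_gt (hx : KKnuthRelations x) {s : Set α} {N : α}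
    (hs : ∀ a ∈ s, a < N) (v : List α) (hv : ∀ a ∈ v, a ∈ s) (hdec : v.Pairwise (· > ·)) :
    x N * (v.map x).prod * x N ∈ DoubleCoset.doubleCoset (x N)
      (Submonoid.closure (x '' s)) (Submonoid.closure (x '' s)) := by
  have mem {a : α} (ha : a ∈ s) : x a ∈ Submonoid.closure (x '' s) :=
    Submonoid.subset_closure ⟨a, ha, rfl⟩
  simp only [DoubleCoset.mem_doubleCoset, SetLike.mem_coe]
  induction v using List.reverseRecOn with
  | nil => exact ⟨1, one_mem _, 1, one_mem _, by simp [hx.idem]⟩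
  | append_singleton v a ih =>
    have ha : a ∈ s := hv a (by simp)
    rcases v.eq_nil_or_concat with rfl | ⟨v, b, rfl⟩
    · exact ⟨x a, mem ha, x a, mem ha, by simp [hx.braid (hs a ha)]⟩
    · have hab : a < b := by grind
      have hbN : b < N := hs b (hv b (by simp))
      obtain ⟨p, hp, q, hq, heq⟩ :=
        ih (fun y hy => hv y (List.mem_append_left _ hy)) (List.pairwise_append.1 hdec).1
      refine ⟨p, hp, q * x a, mul_mem hq (mem ha), ?_⟩
      calc _ = x N * (v.map x).prod * (x b * x a * x N) := by simp [mul_assoc]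
        _ = x N * ((v.concat b).map x).prod * x N * x a := by
          simp [hx.bac hab hbN, mul_assoc]
        _ = p * x N * (q * x a) := by rw [heq, mul_assoc]

theorem mul_prod_mul_mem_doubleCoset (hx : KKnuthRelations x) {s : Set α} {N : α}
    (hs : ∀ a ∈ s, a < N) (v : List α) (hv : ∀ a ∈ v, a ∈ s) :
    x N * (v.map x).prod * x N ∈ DoubleCoset.doubleCoset (x N)
      (Submonoid.closure (x '' s)) (Submonoid.closure (x '' s)) := by
  induction hn : v.length using Nat.strong_induction_on generalizing v with
  | _ n ih =>
  subst hn
  rcases hx.pairwise_gt_or_exists_shorter_or_ascent v with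
    hdec | ⟨v', hsub, hprod, hshort | ⟨hle, a, b, t, rfl, hab⟩⟩
  · exact hx.mul_prod_mul_mem_doubleCoset_of_pairwise_gt hs v hv hdec
  · exact hprod ▸ ih _ hshort v' (fun a ha => hv a (hsub ha)) rfl
  · have hv' : ∀ y ∈ a :: b :: t, y ∈ s := fun y hy => hv y (hsub hy)
    have hbN : b < N := hs b (hv' b (by simp))
    obtain ⟨p, hp, q, hq, heq⟩ := DoubleCoset.mem_doubleCoset.1
      (ih _ hle (b :: t) (fun y hy => hv' y (.tail _ hy)) rfl)
    refine DoubleCoset.mem_doubleCoset.2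
      ⟨x a * p, mul_mem (Submonoid.subset_closure ⟨a, hv' a (by simp), rfl⟩) hp, q, hq, ?_⟩
    calc _ = x N * x a * x b * (t.map x).prod * x N := by simp [← hprod, mul_assoc]
      _ = x a * (x N * ((b :: t).map x).prod * x N) := by
        rw [← hx.acb hab hbN]; simp [mul_assoc]
      _ = x a * p * x N * q := by simp only [heq, mul_assoc]

theorem closure_image_insert_subset (hx : KKnuthRelations x) {s : Set α} {N : α}
    (hs : ∀ a ∈ s, a < N) :
    (Submonoid.closure (x '' insert N s) : Set M) ⊆
      Submonoid.closure (x '' s) ∪ DoubleCoset.doubleCoset (x N)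
        (Submonoid.closure (x '' s)) (Submonoid.closure (x '' s)) := by
  intro y hy
  induction hy using Submonoid.closure_induction_left with
  | one => exact .inl (one_mem _)
  | mul_left y hy z _ hz =>
    simp only [Set.mem_union, DoubleCoset.mem_doubleCoset, SetLike.mem_coe] at hz ⊢
    obtain ⟨a, rfl | ha, rfl⟩ := hy
    · rcases hz with hz | ⟨p, hp, q, hq, rfl⟩
      · exact .inr ⟨1, one_mem _, z, hz, by simp⟩
      · obtain ⟨v, hv, rfl⟩ := exists_list_of_mem_closure_image hp
        obtain ⟨p', hp', q', hq', heq⟩ :=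
          DoubleCoset.mem_doubleCoset.1 (hx.mul_prod_mul_mem_doubleCoset hs v hv)
        refine .inr ⟨p', hp', q' * q, mul_mem hq' hq, ?_⟩
        rw [← mul_assoc, ← mul_assoc, heq, mul_assoc _ q']
    · have hxa : x a ∈ Submonoid.closure (x '' s) := Submonoid.subset_closure ⟨a, ha, rfl⟩
      rcases hz with hz | ⟨p, hp, q, hq, rfl⟩
      · exact .inl (mul_mem hxa hz)
      · exact .inr ⟨x a * p, mul_mem hxa hp, q, hq, by simp only [mul_assoc]⟩

theorem closure_image_finite (hx : KKnuthRelations x) (s : Finset α) :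
    (Submonoid.closure (x '' s) : Set M).Finite := by
  induction s using Finset.induction_on_max with
  | empty => simp
  | insert N s hs ih =>
    rw [Finset.coe_insert]
    refine (ih.union ?_).subset (hx.closure_image_insert_subset hs)
    exact (ih.mul (Set.finite_singleton _)).mul ih

end KKnuthRelations

end KKnuthMonoid

namespace Word

theorem WeakKKnuthStep.append_right {u v : Word} (h : WeakKKnuthStep u v) (w : Word) :
    WeakKKnuthStep (u ++ w) (v ++ w) := by
  cases h with
  | idem u v a => simpa using WeakKKnuthStep.idem u (v ++ w) a
  | braid u v a b hab => simpa using WeakKKnuthStep.braid u (v ++ w) a b hab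
  | bac u v a b c hab hbc => simpa using WeakKKnuthStep.bac u (v ++ w) a b c hab hbc
  | acb u v a b c hab hbc => simpa using WeakKKnuthStep.acb u (v ++ w) a b c hab hbc
  | swap u a b hab => exact WeakKKnuthStep.swap (u ++ w) a b hab

/-- The action of a letter on weak K-Knuth classes by appending it on the right. The opposite
monoid makes the product over the letters of a word append them from left to right. -/
def appendLetter (a : ℕ+) : (Function.End (Quot WeakKKnuthStep))ᵐᵒᵖ :=
  .op (Quot.map (· ++ [a]) fun _ _ h => h.append_right [a])

theorem unop_prod_map_appendLetter (w u : Word) :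
    (w.map appendLetter).prod.unop (Quot.mk WeakKKnuthStep u) = Quot.mk _ (u ++ w) := by
  induction w generalizing u with
  | nil => simp [Function.End.one_def]
  | cons a w ih =>
    rw [List.append_cons, ← ih]
    rfl

theorem prod_map_appendLetter_eq {v w : Word} (h : ∀ u, WeakKKnuthStep (u ++ v) (u ++ w)) :
    (v.map appendLetter).prod = (w.map appendLetter).prod := by
  refine MulOpposite.unop_injective (funext fun q => ?_)
  induction q using Quot.ind with
  | mk u => rw [unop_prod_map_appendLetter, unop_prod_map_appendLetter, Quot.sound (h u)]

theorem kKnuthRelations_appendLetter : KKnuthRelations appendLetter where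
  idem a := by
    simpa using
      prod_map_appendLetter_eq (v := [a, a]) (w := [a])
        fun u => by simpa using WeakKKnuthStep.idem u [] a
  braid {a b} hab := by
    simpa [mul_assoc] using
      prod_map_appendLetter_eq (v := [a, b, a]) (w := [b, a, b])
        fun u => by simpa using WeakKKnuthStep.braid u [] a b hab
  bac {a b c} hab hbc := by
    simpa [mul_assoc] using
      prod_map_appendLetter_eq (v := [b, a, c]) (w := [b, c, a])
        fun u => by simpa using WeakKKnuthStep.bac u [] a b c hab hbc
  acb {a b c} hab hbc := by
    simpa [mul_assoc] using
      prod_map_appendLetter_eq (v := [a, c, b]) (w := [c, a, b])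
        fun u => by simpa using WeakKKnuthStep.acb u [] a b c hab hbc

theorem finite_weakKKnuth_classes (N : ℕ) :
    (Quot.mk WeakKKnuthStep '' {w | maxLetter w ≤ N}).Finite := by
  have hfin : {a : ℕ+ | (a : ℕ) ≤ N}.Finite :=
    (Set.finite_Iic N).preimage PNat.coe_injective.injOn
  refine ((kKnuthRelations_appendLetter.closure_image_finite hfin.toFinset).image
    fun y => y.unop (Quot.mk _ [])).subset ?_
  rintro _ ⟨w, hw, rfl⟩
  rw [Set.mem_ofPred_eq, maxLetter_le_iff] at hw
  refine ⟨(w.map appendLetter).prod, list_prod_mem fun y hy => ?_, by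
    simp [unop_prod_map_appendLetter]⟩
  obtain ⟨a, ha, rfl⟩ := List.mem_map.1 hy
  exact Submonoid.subset_closure ⟨a, by simpa using hw a ha, rfl⟩

end Word

namespace Word

/-- A relabelling is an increasing partial map on letters whose domain is an interval; applied to
the letters of a word, it discards those outside its domain. -/
structure IsRelabelling (g : ℕ+ → Option ℕ+) : Prop where
  isSome_of_between {a b c : ℕ+} : a < b → b < c → (g a).isSome → (g c).isSome → (g b).isSome
  strictMono {a b x y : ℕ+} : a < b → g a = some x → g b = some y → x < y

theorem WeakKKnuthStep.filterMap {g : ℕ+ → Option ℕ+} (hg : IsRelabelling g) {u v : Word}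
    (h : WeakKKnuthStep u v) : WeakKKnuth (u.filterMap g) (v.filterMap g) := by
  have refl (w : Word) : WeakKKnuth w w := .refl w
  have step {w w' : Word} (h : WeakKKnuthStep w w') : WeakKKnuth w w' := .rel _ _ h
  have symm {w w' : Word} (h : WeakKKnuth w w') : WeakKKnuth w' w := .symm _ _ h
  cases h with
  | idem u v a =>
    rcases ha : g a with _ | x
    · simpa [ha] using refl _
    · simpa [ha] using step (.idem (u.filterMap g) (v.filterMap g) x)
  | braid u v a b hab =>
    rcases ha : g a with _ | x <;> rcases hb : g b with _ | y
    · simpa [ha, hb] using refl _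
    · simpa [ha, hb] using symm (step (.idem (u.filterMap g) (v.filterMap g) y))
    · simpa [ha, hb] using step (.idem (u.filterMap g) (v.filterMap g) x)
    · simpa [ha, hb] using
        step (.braid (u.filterMap g) (v.filterMap g) x y (hg.strictMono hab ha hb))
  | bac u v a b c hab hbc =>
    rcases ha : g a with _ | x
    · simpa [ha, List.filterMap_cons] using refl _
    rcases hc : g c with _ | z
    · simpa [hc, List.filterMap_cons] using refl _
    obtain ⟨y, hb⟩ := Option.isSome_iff_exists.1
      (hg.isSome_of_between hab hbc (by simp [ha]) (by simp [hc]))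
    simpa [ha, hb, hc] using step (.bac (u.filterMap g) (v.filterMap g) x y z
      (hg.strictMono hab ha hb) (hg.strictMono hbc hb hc))
  | acb u v a b c hab hbc =>
    rcases ha : g a with _ | x
    · simpa [ha, List.filterMap_cons] using refl _
    rcases hc : g c with _ | z
    · simpa [hc, List.filterMap_cons] using refl _
    obtain ⟨y, hb⟩ := Option.isSome_iff_exists.1
      (hg.isSome_of_between hab hbc (by simp [ha]) (by simp [hc]))
    simpa [ha, hb, hc] using step (.acb (u.filterMap g) (v.filterMap g) x y z
      (hg.strictMono hab ha hb) (hg.strictMono hbc hb hc))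
  | swap u a b hab =>
    rcases ha : g a with _ | x
    · simpa [ha, List.filterMap_cons] using refl _
    rcases hb : g b with _ | y
    · simpa [hb, List.filterMap_cons] using refl _
    simpa [ha, hb] using step (.swap (u.filterMap g) x y (hg.strictMono hab ha hb))

theorem WeakKKnuth.filterMap {g : ℕ+ → Option ℕ+} (hg : IsRelabelling g) {u v : Word}
    (h : WeakKKnuth u v) : WeakKKnuth (u.filterMap g) (v.filterMap g) := by
  induction h with
  | rel _ _ h => exact h.filterMap hg
  | refl => exact .refl _
  | symm _ _ _ ih => exact ih.symm
  | trans _ _ _ _ _ ih ih' => exact ih.trans _ _ _ ih'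

theorem WeakKKnuth.mem_iff {u v : Word} (h : WeakKKnuth u v) (a : ℕ+) : a ∈ u ↔ a ∈ v := by
  induction h with
  | rel _ _ h => cases h <;> grind
  | refl => rfl
  | symm _ _ _ ih => exact ih.symm
  | trans _ _ _ _ _ ih ih' => exact ih.trans ih'

theorem WeakKKnuth.maxLetter_eq {u v : Word} (h : WeakKKnuth u v) : maxLetter u = maxLetter v :=
  eq_of_forall_ge_iff fun n => by simp only [maxLetter_le_iff, h.mem_iff]

theorem WeakKKnuth.isInitial_iff {u v : Word} (h : WeakKKnuth u v) : IsInitial u ↔ IsInitial v := by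
  simp only [IsInitial, h.mem_iff]

theorem shiftLetter_strictMono (n : ℕ) : StrictMono (shiftLetter n) :=
  fun a b h => Nat.add_lt_add_right (PNat.coe_lt_coe a b |>.2 h) n

theorem exists_shiftLetter_eq {n : ℕ} {a : ℕ+} : (∃ b, shiftLetter n b = a) ↔ n < a :=
  ⟨by rintro ⟨b, rfl⟩; exact Nat.lt_add_of_pos_left b.pos,
    fun h => ⟨⟨a - n, Nat.sub_pos_of_lt h⟩, PNat.eq (Nat.sub_add_cancel h.le)⟩⟩

theorem lt_of_mem_shift {n : ℕ} {w : Word} {a : ℕ+} (ha : a ∈ shift n w) : n < a := by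
  obtain ⟨b, -, rfl⟩ := List.mem_map.1 ha
  exact exists_shiftLetter_eq.1 ⟨b, rfl⟩

/-- The subword of the letters that are at most `n`. -/
def lowPart (n : ℕ) (w : Word) : Word := w.filter fun a => (a : ℕ) ≤ n

/-- The subword of the letters larger than `n`, each decreased by `n`. -/
noncomputable def highPart (n : ℕ) (w : Word) : Word :=
  w.filterMap (Function.partialInv (shiftLetter n))

theorem isRelabelling_guard_le (n : ℕ) :
    IsRelabelling (Option.guard fun a : ℕ+ => (a : ℕ) ≤ n) where
  isSome_of_between {a b c} _ hbc _ hc := by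
    have : (b : ℕ) < c := hbc
    simp only [Option.isSome_guard, decide_eq_true_eq] at hc ⊢
    lia
  strictMono hab hx hy := by
    rw [Option.guard_eq_some_iff] at hx hy
    exact hx.1 ▸ hy.1 ▸ hab

theorem isRelabelling_partialInv_shiftLetter (n : ℕ) :
    IsRelabelling (Function.partialInv (shiftLetter n)) := by
  have hinv := (shiftLetter_injective n).isPartialInv
  refine ⟨fun {a b c} hab _ ha _ => ?_, fun hab hx hy => ?_⟩
  · simp only [Option.isSome_iff_exists, hinv _ _, exists_shiftLetter_eq] at ha ⊢
    exact ha.trans hab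
  · rwa [← (hinv _ _).1 hx, ← (hinv _ _).1 hy, (shiftLetter_strictMono n).lt_iff_lt] at hab

theorem WeakKKnuth.lowPart {u v : Word} (h : WeakKKnuth u v) (n : ℕ) :
    WeakKKnuth (lowPart n u) (lowPart n v) := by
  simpa only [Word.lowPart, List.filterMap_eq_filter] using h.filterMap (isRelabelling_guard_le n)

theorem WeakKKnuth.highPart {u v : Word} (h : WeakKKnuth u v) (n : ℕ) :
    WeakKKnuth (highPart n u) (highPart n v) :=
  h.filterMap (isRelabelling_partialInv_shiftLetter n)

theorem mem_lowPart {n : ℕ} {w : Word} {a : ℕ+} : a ∈ lowPart n w ↔ a ∈ w ∧ (a : ℕ) ≤ n := by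
  simp [lowPart]

theorem mem_highPart {n : ℕ} {w : Word} {a : ℕ+} : a ∈ highPart n w ↔ shiftLetter n a ∈ w := by
  simp only [highPart, List.mem_filterMap, (shiftLetter_injective n).isPartialInv _ _,
    exists_eq_right']

theorem shift_highPart (n : ℕ) (w : Word) :
    shift n (highPart n w) = w.filter fun a : ℕ+ => ¬ (a : ℕ) ≤ n := by
  have hinv := (shiftLetter_injective n).isPartialInv
  rw [shift, highPart, List.map_filterMap, ← List.filterMap_eq_filter]
  congr 1
  funext a
  by_cases ha : n < a
  · obtain ⟨b, rfl⟩ := exists_shiftLetter_eq.2 ha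
    simp [(hinv b _).2 rfl, ha]
  · have hnone : Function.partialInv (shiftLetter n) a = none :=
      Option.eq_none_iff_forall_ne_some.2 fun b hb =>
        ha (exists_shiftLetter_eq.1 ⟨b, (hinv b a).1 hb⟩)
    rw [hnone, Option.map_none, eq_comm, Option.guard_eq_none_iff]
    simpa using ha

theorem count_map_cons (a c : ℕ+) (m : Multiset Word) (u : Word) :
    (m.map (List.cons a)).count (c :: u) = if a = c then m.count u else 0 := by
  split_ifs with h
  · subst h
    exact Multiset.count_map_eq_count' _ _ List.cons_injective u
  · rw [Multiset.count_eq_zero, Multiset.mem_map]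
    rintro ⟨v, -, hv⟩
    exact h (List.cons.inj hv).1

theorem count_shuffle_of_disjoint (p : ℕ+ → Prop) [DecidablePred p] {w v : Word}
    (hw : ∀ a ∈ w, p a) (hv : ∀ a ∈ v, ¬ p a) (u : Word) :
    (shuffle w v).count u = if u.filter (p ·) = w ∧ u.filter (¬ p ·) = v then 1 else 0 := by
  fun_induction shuffle w v generalizing u with
  | case1 v =>
    rw [Multiset.count_singleton]
    refine if_congr ⟨?_, ?_⟩ rfl rfl
    · rintro rfl
      simpa using hv
    · rintro ⟨hnil, rfl⟩
      rw [eq_comm, List.filter_eq_self]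
      simpa using hnil
  | case2 a w =>
    rw [Multiset.count_singleton]
    refine if_congr ⟨?_, ?_⟩ rfl rfl
    · rintro rfl
      simpa using hw
    · rintro ⟨heq, hnil⟩
      rw [← heq, eq_comm, List.filter_eq_self]
      simpa using hnil
  | case3 a w b v ih1 ih2 =>
    cases u with
    | nil => simp
    | cons c u =>
      have ha := hw a (by simp)
      have hb := hv b (by simp)
      rw [Multiset.count_add, count_map_cons, count_map_cons,
        ih1 (by grind) (by grind), ih2 (by grind) (by grind)]
      by_cases hc : p c
      · have hbc : b ≠ c := fun h => hb (h ▸ hc)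
        simp [hc, hbc, ← ite_and, and_assoc, eq_comm]
      · have hac : a ≠ c := fun h => hc (h ▸ ha)
        simp [hc, hac, ← ite_and, and_left_comm, eq_comm]

theorem IsInitial.of_lowPart_of_highPart {k : ℕ+} {u : Word}
    (hlow : ∀ a, a ∈ lowPart k u ↔ a ≤ k) (hhigh : IsInitial (highPart k u)) : IsInitial u := by
  obtain ⟨l, hl⟩ := hhigh
  refine ⟨shiftLetter k l, fun a => ?_⟩
  by_cases hak : a ≤ k
  · have hkl : k ≤ shiftLetter k l := Nat.le_add_left _ _
    simp [((mem_lowPart.1 ((hlow a).2 hak)).1), hak.trans hkl]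
  · obtain ⟨b, rfl⟩ := exists_shiftLetter_eq.2 (show (k : ℕ) < a from not_le.1 hak)
    rw [← mem_highPart, hl, (shiftLetter_strictMono k).le_iff_le]

theorem maxLetter_eq_of_forall_mem_iff {k : ℕ+} {h : Word} (hk : ∀ a, a ∈ h ↔ a ≤ k) :
    maxLetter h = k :=
  le_antisymm ((maxLetter_le_iff h k).2 fun a ha => (hk a).1 ha)
    ((maxLetter_le_iff h _).1 le_rfl k ((hk k).2 le_rfl))

end Word

namespace WordSeries

open Word

theorem add_apply (F G : WordSeries) (u : Word) : (F + G) u = F u + G u := rfl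

theorem smul_apply (r : ℝ) (F : WordSeries) (u : Word) : (r • F) u = r * F u := rfl

theorem sum_apply {ι : Type*} (s : Finset ι) (F : ι → WordSeries) (u : Word) :
    (∑ i ∈ s, F i) u = ∑ i ∈ s, F i u :=
  Finset.sum_apply u s F

theorem wordClass_eq_zero_iff {h w : Word} : wordClass h w = 0 ↔ ¬ WeakKKnuth h w := by
  simp [wordClass]

theorem wordClass_congr {h u v : Word} (huv : WeakKKnuth u v) : wordClass h u = wordClass h v := by
  classical
  have : WeakKKnuth h u ↔ WeakKKnuth h v := ⟨(.trans _ _ _ · huv), (.trans _ _ _ · (.symm _ _ huv))⟩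
  exact if_congr this rfl rfl

open Classical in
theorem wordClass_out (q : Quot WeakKKnuthStep) (u : Word) :
    wordClass q.out u = if q = Quot.mk _ u then 1 else 0 := by
  refine if_congr ⟨fun h => ?_, fun h => ?_⟩ rfl rfl
  · rw [← q.out_eq, Quot.eqvGen_sound h]
  · exact Quot.eqvGen_exact (by rw [q.out_eq, h])

theorem maxLetter_eq_add_of_shuffleCoeff_ne_zero {w w' u : Word} (h : shuffleCoeff w w' u ≠ 0) :
    maxLetter u = maxLetter w + maxLetter w' := by
  rw [maxLetter_shuffle (Multiset.count_ne_zero.1 h), max_maxLetter_shift]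

theorem shuffleCoeff_eq_ite (w w' u : Word) :
    shuffleCoeff w w' u =
      if lowPart (maxLetter w) u = w ∧ highPart (maxLetter w) u = w' then 1 else 0 := by
  rw [shuffleCoeff, count_shuffle_of_disjoint (fun a => (a : ℕ) ≤ maxLetter w)
    ((maxLetter_le_iff w _).1 le_rfl) (fun _ ha => not_le.2 (lt_of_mem_shift ha)), ← shift_highPart]
  exact if_congr (and_congr_right' (shift_injective _).eq_iff) rfl rfl

theorem mul_apply_of_maxLetter_eq {F : WordSeries} {n : ℕ} (hF : ∀ w, F w ≠ 0 → maxLetter w = n)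
    (G : WordSeries) (u : Word) : (F * G) u = F (lowPart n u) * G (highPart n u) := by
  rw [mul_apply, finsum_eq_single _ (lowPart n u, highPart n u)]
  · by_cases h0 : F (lowPart n u) = 0
    · simp [h0]
    · simp [shuffleCoeff_eq_ite, hF _ h0]
  · rintro ⟨w, w'⟩ hne
    by_cases h0 : F w = 0
    · simp [h0]
    · have : ¬ (lowPart n u = w ∧ highPart n u = w') := by
        rintro ⟨rfl, rfl⟩
        exact hne rfl
      simp [shuffleCoeff_eq_ite, hF _ h0, this]

theorem maxLetter_le_add_of_mul_apply_ne_zero {F G : WordSeries} {N N' : ℕ}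
    (hF : ∀ w, F w ≠ 0 → maxLetter w ≤ N) (hG : ∀ w, G w ≠ 0 → maxLetter w ≤ N') {u : Word}
    (hu : (F * G) u ≠ 0) : maxLetter u ≤ N + N' := by
  obtain ⟨p, hp⟩ := not_forall.1 (mt finsum_eq_zero_of_forall_eq_zero hu)
  rw [maxLetter_eq_add_of_shuffleCoeff_ne_zero (Nat.cast_ne_zero.1 (right_ne_zero_of_mul hp))]
  have hFG := left_ne_zero_of_mul hp
  exact add_le_add (hF _ (left_ne_zero_of_mul hFG)) (hG _ (right_ne_zero_of_mul hFG))

/-- The word series of bounded letters: those for which the words occurring have their letters in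
a common finite set. -/
def boundedLetters : NonUnitalSubalgebra ℝ WordSeries where
  carrier := {F | ∃ N, ∀ w, F w ≠ 0 → maxLetter w ≤ N}
  zero_mem' := ⟨0, fun _ h => absurd rfl h⟩
  add_mem' := by
    rintro F G ⟨N, hN⟩ ⟨N', hN'⟩
    refine ⟨max N N', fun w hw => ?_⟩
    by_cases hF : F w = 0
    · exact le_max_of_le_right (hN' w fun hG => hw (by simp [add_apply, hF, hG]))
    · exact le_max_of_le_left (hN w hF)
  smul_mem' := by
    rintro r F ⟨N, hN⟩
    exact ⟨N, fun w hw => hN w (right_ne_zero_of_mul hw)⟩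
  mul_mem' := by
    rintro F G ⟨N, hN⟩ ⟨N', hN'⟩
    exact ⟨N + N', fun u => maxLetter_le_add_of_mul_apply_ne_zero hN hN'⟩

theorem wordClass_mem_boundedLetters (h : Word) : wordClass h ∈ boundedLetters :=
  ⟨maxLetter h, fun _ hw => (not_not.1 (wordClass_eq_zero_iff.not.1 hw)).maxLetter_eq.ge⟩

theorem SKPR_le_boundedLetters : SKPR ≤ boundedLetters.toSubmodule := by
  refine Submodule.span_le.2 ?_
  rintro _ ⟨h, -, rfl⟩
  exact wordClass_mem_boundedLetters h

theorem mem_SKPR_of_weakKKnuth_invariant {F : WordSeries} (hF : F ∈ boundedLetters)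
    (hinit : ∀ w, F w ≠ 0 → IsInitial w) (hinv : ∀ u v, WeakKKnuth u v → F u = F v) :
    F ∈ SKPR := by
  classical
  obtain ⟨N, hN⟩ := hF
  let classes := (finite_weakKKnuth_classes N).toFinset
  have hsum : F = ∑ q ∈ classes, F q.out • wordClass q.out := by
    ext u
    have hu : F (Quot.mk WeakKKnuthStep u).out = F u :=
      hinv _ _ (Quot.eqvGen_exact (Quot.out_eq _))
    simp only [sum_apply, smul_apply, wordClass_out, mul_ite, mul_one, mul_zero,
      Finset.sum_ite_eq', hu]
    refine (ite_eq_left_iff.2 fun hnot => ?_).symm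
    by_contra h0
    exact hnot (by simpa [classes] using ⟨u, hN u (Ne.symm h0), rfl⟩)
  rw [hsum]
  refine Submodule.sum_mem _ fun q _ => ?_
  by_cases h0 : F q.out = 0
  · simp [h0]
  · exact Submodule.smul_mem _ _ (Submodule.subset_span ⟨q.out, hinit _ h0, rfl⟩)

theorem wordClass_mul_apply (h h' u : Word) :
    (wordClass h * wordClass h') u =
      wordClass h (lowPart (maxLetter h) u) * wordClass h' (highPart (maxLetter h) u) :=
  mul_apply_of_maxLetter_eq
    (fun _ hw => (not_not.1 (wordClass_eq_zero_iff.not.1 hw)).maxLetter_eq.symm) _ u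

theorem wordClass_mul_wordClass_mem_SKPR {h h' : Word} (hh : IsInitial h) (hh' : IsInitial h') :
    wordClass h * wordClass h' ∈ SKPR := by
  obtain ⟨k, hk⟩ := hh
  have hmax := maxLetter_eq_of_forall_mem_iff hk
  refine mem_SKPR_of_weakKKnuth_invariant
    (mul_mem (wordClass_mem_boundedLetters h) (wordClass_mem_boundedLetters h'))
    (fun u hu => ?_) fun u v huv => ?_
  · simp only [wordClass_mul_apply, hmax, mul_ne_zero_iff, ne_eq, wordClass_eq_zero_iff,
      not_not] at hu
    exact .of_lowPart_of_highPart (fun a => by rw [← hu.1.mem_iff, hk])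
      (hu.2.isInitial_iff.1 hh')
  · rw [wordClass_mul_apply, wordClass_mul_apply, wordClass_congr (huv.lowPart _),
      wordClass_congr (huv.highPart _)]

theorem mul_mem_SKPR {F G : WordSeries} (hF : F ∈ SKPR) (hG : G ∈ SKPR) : F * G ∈ SKPR := by
  have hle : Submodule.map₂ (LinearMap.mul ℝ WordSeries) SKPR SKPR ≤ SKPR := by
    rw [SKPR, Submodule.map₂_span_span, Submodule.span_le]
    rintro _ ⟨_, ⟨h, hh, rfl⟩, _, ⟨h', hh', rfl⟩, rfl⟩
    exact wordClass_mul_wordClass_mem_SKPR hh hh'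
  exact hle (Submodule.apply_mem_map₂ _ hF hG)

end WordSeries

section Fundamental

/-- The sequences `s` indexing the terms of the fundamental quasisymmetric function `f_D` of
degree `n` whose monomial has exponent vector `m`. Allowing any linear order `α` for the indices of
the variables makes the terms functorial in order embeddings. -/
def compatibleSeqs {α : Type*} [LinearOrder α] (n : ℕ) (D : Set ℕ) (m : α →₀ ℕ) :
    Set (Fin n → α) :=
  {s | Monotone s ∧ (∀ (j : ℕ) (hj : j + 1 < n), j ∈ D → s ⟨j, by lia⟩ < s ⟨j + 1, hj⟩) ∧
    ∑ t, Finsupp.single (s t) 1 = m}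

theorem coeff_fundamental (n : ℕ) (D : Set ℕ) (m : ℕ+ →₀ ℕ) :
    MvPowerSeries.coeff m (fundamental n D) = (compatibleSeqs n D m).ncard :=
  rfl

variable {α β : Type*} [LinearOrder α] [LinearOrder β]

theorem mem_support_of_mem_compatibleSeqs {n : ℕ} {D : Set ℕ} {m : α →₀ ℕ} {s : Fin n → α}
    (hs : s ∈ compatibleSeqs n D m) (t : Fin n) : s t ∈ m.support := by
  obtain ⟨-, -, rfl⟩ := hs
  rw [Finsupp.mem_support_iff, Finsupp.finsetSum_apply]
  exact (Finset.sum_pos' (fun _ _ => Nat.zero_le _)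
    ⟨t, Finset.mem_univ t, by simp⟩).ne'

theorem compatibleSeqs_embDomain (n : ℕ) (D : Set ℕ) (i : α ↪o β) (a : α →₀ ℕ) :
    compatibleSeqs n D (a.embDomain i.toEmbedding) = (i ∘ ·) '' compatibleSeqs n D a := by
  have comp_mem_iff (s : Fin n → α) :
      i ∘ s ∈ compatibleSeqs n D (a.embDomain i.toEmbedding) ↔ s ∈ compatibleSeqs n D a := by
    have hsum : ∑ t, Finsupp.single (i (s t)) 1 =
        (∑ t, Finsupp.single (s t) 1).embDomain i.toEmbedding := by
      simp only [Finsupp.embDomain_eq_mapDomain, Finsupp.mapDomain_finsetSum,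
        Finsupp.mapDomain_single, RelEmbedding.coe_toEmbedding]
    simp only [compatibleSeqs, Monotone, Set.mem_ofPred_eq, Function.comp_apply, i.le_iff_le,
      i.lt_iff_lt, hsum, Finsupp.embDomain_inj]
  refine Set.Subset.antisymm (fun s hs => ?_) ?_
  · have hrange : ∀ t, ∃ b, i b = s t := fun t => by
      have := mem_support_of_mem_compatibleSeqs hs t
      rw [Finsupp.support_embDomain, Finset.mem_map] at this
      obtain ⟨b, -, hb⟩ := this
      exact ⟨b, hb⟩
    choose s' hs' using hrange
    obtain rfl : i ∘ s' = s := funext hs'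
    exact ⟨s', (comp_mem_iff s').1 hs, rfl⟩
  · rintro _ ⟨s, hs, rfl⟩
    exact (comp_mem_iff s).2 hs

theorem isQuasisymmetric_fundamental (n : ℕ) (D : Set ℕ) : IsQuasisymmetric (fundamental n D) := by
  have ncard_eq {k : ℕ} (i : Fin k ↪o ℕ+) (a : Fin k →₀ ℕ) :
      (compatibleSeqs n D (a.embDomain i.toEmbedding)).ncard = (compatibleSeqs n D a).ncard := by
    rw [compatibleSeqs_embDomain, Set.ncard_image_of_injective _ i.injective.comp_left]
  intro k i j a
  rw [coeff_fundamental, coeff_fundamental, ncard_eq, ncard_eq]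

end Fundamental

/-- A biword is a two-rowed array whose columns are in weakly increasing lexicographic order. It is
determined by the multiset of its columns, which encodes it here. -/
abbrev Biword (α β : Type*) : Type _ := Multiset (α ×ₗ β)

namespace Biword

/-- The top row of a biword. It is weakly increasing, so no information is lost by recording it as a
multiset. -/
def topRow {α β : Type*} (P : Biword α β) : Multiset α := P.map fun c => (ofLex c).1

/-- The biword consisting of the columns whose bottom entry satisfies `p`. -/
def restrict {α β : Type*} (p : β → Prop) [DecidablePred p] (P : Biword α β) : Biword α β :=
  P.filter fun c => p (ofLex c).2

theorem topRow_add {α β : Type*} (P Q : Biword α β) : topRow (P + Q) = topRow P + topRow Q :=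
  Multiset.map_add _ P Q

theorem restrict_add_restrict_not {α β : Type*} (p : β → Prop) [DecidablePred p]
    (P : Biword α β) : restrict p P + restrict (¬ p ·) P = P :=
  Multiset.filter_add_not _ P

variable {α β : Type*} [LinearOrder α] [LinearOrder β]

/-- The bottom row of a biword, read from left to right. -/
def bottomRow (P : Biword α β) : List β := (P.sort (· ≤ ·)).map fun c => (ofLex c).2

theorem sort_coe_of_pairwise {l : List α} (hl : l.Pairwise (· ≤ ·)) :
    (l : Multiset α).sort (· ≤ ·) = l := by
  rw [Multiset.coe_sort, List.mergeSort_eq_self _ (by simpa using hl)]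

theorem bottomRow_coe {l : List (α ×ₗ β)} (hl : l.Pairwise (· ≤ ·)) :
    bottomRow (l : Multiset (α ×ₗ β)) = l.map fun c => (ofLex c).2 := by
  rw [bottomRow, sort_coe_of_pairwise hl]

theorem map_fst_sort (P : Biword α β) :
    (P.sort (· ≤ ·)).map (fun c => (ofLex c).1) = (topRow P).sort (· ≤ ·) := by
  have hsorted : ((P.sort (· ≤ ·)).map fun c => (ofLex c).1).Pairwise (· ≤ ·) :=
    List.pairwise_map.2 ((P.pairwise_sort (· ≤ ·)).imp fun h => Prod.Lex.monotone_fst _ _ h)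
  rw [← sort_coe_of_pairwise hsorted, ← Multiset.map_coe, Multiset.sort_eq, topRow]

theorem eq_of_rows_eq {P Q : Biword α β} (htop : topRow P = topRow Q)
    (hbottom : bottomRow P = bottomRow Q) : P = Q := by
  have sort_eq_zip (R : Biword α β) :
      R.sort (· ≤ ·) = ((topRow R).sort (· ≤ ·)).zip (bottomRow R) :=
    List.zip_of_prod (map_fst_sort R) rfl
  rw [← P.sort_eq (· ≤ ·), ← Q.sort_eq (· ≤ ·), sort_eq_zip P, sort_eq_zip Q, htop, hbottom]

theorem length_bottomRow (P : Biword α β) : (bottomRow P).length = (topRow P).card := by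
  simp [bottomRow, topRow]

theorem coe_bottomRow (P : Biword α β) :
    (bottomRow P : Multiset β) = P.map fun c => (ofLex c).2 := by
  rw [bottomRow, ← Multiset.map_coe, Multiset.sort_eq]

theorem mem_bottomRow {P : Biword α β} {b : β} : b ∈ bottomRow P ↔ ∃ c ∈ P, (ofLex c).2 = b := by
  rw [← Multiset.mem_coe, coe_bottomRow, Multiset.mem_map]

theorem bottomRow_restrict (p : β → Prop) [DecidablePred p] (P : Biword α β) :
    bottomRow (restrict p P) = (bottomRow P).filter (p ·) := by
  conv_lhs => rw [← P.sort_eq (· ≤ ·), restrict, Multiset.filter_coe]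
  rw [bottomRow_coe ((P.pairwise_sort (· ≤ ·)).filter _), bottomRow, List.filter_map]
  rfl

theorem restrict_add_of_disjoint (p : β → Prop) [DecidablePred p] {P Q : Biword α β}
    (hP : ∀ b ∈ bottomRow P, p b) (hQ : ∀ b ∈ bottomRow Q, ¬ p b) :
    restrict p (P + Q) = P := by
  rw [restrict, Multiset.filter_add,
    Multiset.filter_eq_self.2 fun c hc => hP _ (mem_bottomRow.2 ⟨c, hc, rfl⟩),
    Multiset.filter_eq_nil.2 fun c hc => hQ _ (mem_bottomRow.2 ⟨c, hc, rfl⟩), add_zero]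

theorem sum_single_eq_iff {n : ℕ} {s : Fin n → α} {m : α →₀ ℕ} :
    ∑ t, Finsupp.single (s t) 1 = m ↔ (List.ofFn s : Multiset α) = Finsupp.toMultiset m := by
  have hsum : Finsupp.toMultiset (∑ t, Finsupp.single (s t) 1) = (List.ofFn s : Multiset α) := by
    rw [Finsupp.toMultiset_sum, ← Fin.univ_val_map, ← Multiset.sum_map_singleton (Multiset.map s _),
      Multiset.map_map]
    simp only [Finsupp.toMultiset_single, one_smul, Finset.sum, Function.comp_apply]
  rw [← Multiset.toFinsupp_eq_iff, ← hsum, Finsupp.toMultiset_toFinsupp]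

theorem pairwise_ofFn_toLex_iff {w : Word} {s : Fin w.length → α} :
    (List.ofFn fun t => toLex (s t, w[t])).Pairwise (· ≤ ·) ↔
      Monotone s ∧ ∀ (j : ℕ) (hj : j + 1 < w.length), j ∈ w.descentSet →
        s ⟨j, by lia⟩ < s ⟨j + 1, hj⟩ := by
  have monotone_iff : Monotone s ↔
      ∀ (j : ℕ) (hj : j + 1 < w.length), s ⟨j, by lia⟩ ≤ s ⟨j + 1, hj⟩ := by
    rw [← List.sortedLE_ofFn_iff, List.sortedLE_iff_isChain, List.isChain_iff_getElem]
    simp only [List.length_ofFn, List.getElem_ofFn]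
  rw [← List.isChain_iff_pairwise, List.isChain_iff_getElem, monotone_iff]
  simp only [List.length_ofFn, List.getElem_ofFn, Prod.Lex.toLex_le_toLex, Word.descentSet,
    Set.mem_ofPred_eq, Fin.getElem_fin, ← forall_and]
  refine forall₂_congr fun j hj => ?_
  simp only [hj, exists_true_left, le_iff_lt_or_eq (a := s _), ← not_lt (α := ℕ+)]
  tauto

theorem ncard_compatibleSeqs_descentSet (w : Word) (m : α →₀ ℕ) :
    (compatibleSeqs w.length w.descentSet m).ncard =
      {P : Biword α ℕ+ | topRow P = Finsupp.toMultiset m ∧ bottomRow P = w}.ncard := by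
  let columns (s : Fin w.length → α) : List (α ×ₗ ℕ+) := List.ofFn fun t => toLex (s t, w[t])
  have mem_iff (s : Fin w.length → α) : s ∈ compatibleSeqs w.length w.descentSet m ↔
      (columns s).Pairwise (· ≤ ·) ∧ (List.ofFn s : Multiset α) = Finsupp.toMultiset m := by
    rw [pairwise_ofFn_toLex_iff, ← sum_single_eq_iff, and_assoc]
    rfl
  have topRow_columns (s) : topRow (columns s : Biword α ℕ+) = List.ofFn s := by
    simp [topRow, columns, List.map_ofFn, Function.comp_def]
  have map_snd_columns (s) : (columns s).map (fun c => (ofLex c).2) = w := by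
    simp [columns, List.map_ofFn, Function.comp_def]
  refine Set.ncard_congr (fun s _ => (columns s : Biword α ℕ+)) (fun s hs => ?_)
    (fun s s' hs hs' heq => ?_) ?_
  · obtain ⟨hsorted, hm⟩ := (mem_iff s).1 hs
    exact ⟨(topRow_columns s).trans hm, (bottomRow_coe hsorted).trans (map_snd_columns s)⟩
  · have := congrArg (Multiset.sort · (· ≤ ·)) heq
    simp only [sort_coe_of_pairwise ((mem_iff _).1 hs).1,
      sort_coe_of_pairwise ((mem_iff _).1 hs').1] at this
    funext t
    exact congrArg (fun c => (ofLex c).1) (congrFun (List.ofFn_injective this) t)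
  · rintro P ⟨htop, rfl⟩
    have hlength : (bottomRow P).length = (P.sort (· ≤ ·)).length := by simp [bottomRow]
    let s (t : Fin (bottomRow P).length) : α := (ofLex ((P.sort (· ≤ ·))[t])).1
    have hcolumns : columns s = P.sort (· ≤ ·) :=
      List.ext_getElem (by simp [columns, bottomRow]) fun i _ _ => by
        simp [columns, s, bottomRow]
    refine ⟨s, (mem_iff s).2 ⟨hcolumns ▸ P.pairwise_sort _, ?_⟩, ?_⟩
    · rw [← topRow_columns, hcolumns, Multiset.sort_eq, htop]
    · rw [hcolumns, Multiset.sort_eq]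

open Classical in
theorem coeff_fundamentalOfWord (w : Word) (m : ℕ+ →₀ ℕ) :
    MvPowerSeries.coeff m (fundamentalOfWord w) =
      if ∃ P : Biword ℕ+ ℕ+, topRow P = Finsupp.toMultiset m ∧ bottomRow P = w then 1 else 0 := by
  rw [fundamentalOfWord, coeff_fundamental, ncard_compatibleSeqs_descentSet]
  split_ifs with h
  · obtain ⟨P, hP⟩ := h
    rw [Nat.cast_eq_one, Set.ncard_eq_one]
    exact ⟨P, Set.eq_singleton_iff_unique_mem.2
      ⟨hP, fun Q hQ => eq_of_rows_eq (hQ.1.trans hP.1.symm) (hQ.2.trans hP.2.symm)⟩⟩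
  · rw [Nat.cast_eq_zero]
    exact (congrArg Set.ncard (Set.eq_empty_of_forall_notMem fun P hP => h ⟨P, hP⟩)).trans
      (Set.ncard_empty _)

theorem length_eq_card_of_coeff_fundamentalOfWord_ne_zero {w : Word} {m : ℕ+ →₀ ℕ}
    (h : MvPowerSeries.coeff m (fundamentalOfWord w) ≠ 0) :
    w.length = (Finsupp.toMultiset m).card := by
  classical
  rw [coeff_fundamentalOfWord, ite_ne_right_iff] at h
  obtain ⟨P, htop, rfl⟩ := h.1
  rw [length_bottomRow, htop]

end Biword

namespace Word

theorem mem_shuffle_of_disjoint (p : ℕ+ → Prop) [DecidablePred p] {w v : Word}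
    (hw : ∀ a ∈ w, p a) (hv : ∀ a ∈ v, ¬ p a) {u : Word} :
    u ∈ shuffle w v ↔ u.filter (p ·) = w ∧ u.filter (¬ p ·) = v := by
  rw [← Multiset.count_ne_zero, count_shuffle_of_disjoint p hw hv, ite_ne_right_iff]
  exact and_iff_left one_ne_zero

theorem nodup_shuffle_of_disjoint (p : ℕ+ → Prop) {w v : Word} (hw : ∀ a ∈ w, p a)
    (hv : ∀ a ∈ v, ¬ p a) : (shuffle w v).Nodup := by
  classical
  refine Multiset.nodup_iff_count_le_one.2 fun u => ?_
  rw [count_shuffle_of_disjoint p hw hv]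
  split_ifs <;> lia

theorem descentSet_shift (n : ℕ) (w : Word) : descentSet (shift n w) = descentSet w := by
  simp only [descentSet, shift, List.length_map, List.getElem_map,
    (shiftLetter_strictMono n).lt_iff_lt]

end Word

theorem fundamentalOfWord_shift (n : ℕ) (w : Word) :
    fundamentalOfWord (w.shift n) = fundamentalOfWord w := by
  rw [fundamentalOfWord, Word.descentSet_shift, Word.shift, List.length_map, fundamentalOfWord]

namespace Biword

variable {α : Type*} [LinearOrder α]

theorem sum_coeff_fundamentalOfWord (S : Finset Word) (m : ℕ+ →₀ ℕ) :
    ∑ u ∈ S, MvPowerSeries.coeff m (fundamentalOfWord u) =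
      {R : Biword ℕ+ ℕ+ | topRow R = Finsupp.toMultiset m ∧ bottomRow R ∈ S}.ncard := by
  classical
  simp only [coeff_fundamentalOfWord]
  rw [Finset.sum_boole, ← Set.ncard_coe_finset, Nat.cast_inj]
  set 𝓡 := {R : Biword ℕ+ ℕ+ | topRow R = Finsupp.toMultiset m ∧ bottomRow R ∈ S}
  have hinj : Set.InjOn bottomRow 𝓡 := fun R hR R' hR' h => eq_of_rows_eq (hR.1.trans hR'.1.symm) h
  rw [← hinj.ncard_image]
  congr 1
  ext u
  simp only [Finset.coe_filter, Set.mem_ofPred_eq, Set.mem_image, 𝓡]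
  grind

theorem exists_rows_and_exists_rows_iff (p : ℕ+ → Prop) [DecidablePred p] {w v : Word}
    (hw : ∀ a ∈ w, p a) (hv : ∀ a ∈ v, ¬ p a) {A B : Multiset α} :
    ((∃ P : Biword α ℕ+, topRow P = A ∧ bottomRow P = w) ∧
      ∃ Q : Biword α ℕ+, topRow Q = B ∧ bottomRow Q = v) ↔
    ∃ R : Biword α ℕ+, (topRow (restrict p R) = A ∧ topRow (restrict (¬ p ·) R) = B) ∧
      (bottomRow R).filter (p ·) = w ∧ (bottomRow R).filter (¬ p ·) = v := by
  constructor
  · rintro ⟨⟨P, rfl, rfl⟩, Q, rfl, rfl⟩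
    have hlow : restrict p (P + Q) = P := restrict_add_of_disjoint p hw hv
    have hhigh : restrict (¬ p ·) (P + Q) = Q := by
      rw [add_comm]
      exact restrict_add_of_disjoint _ hv fun c hc => not_not.2 (hw c hc)
    refine ⟨P + Q, ⟨?_, ?_⟩, ?_, ?_⟩
    · rw [hlow]
    · rw [hhigh]
    · rw [← bottomRow_restrict, hlow]
    · rw [← bottomRow_restrict, hhigh]
  · rintro ⟨R, ⟨hA, hB⟩, rfl, rfl⟩
    exact ⟨⟨_, hA, bottomRow_restrict p R⟩, _, hB, bottomRow_restrict (¬ p ·) R⟩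

theorem coeff_fundamentalOfWord_mul (p : ℕ+ → Prop) [DecidablePred p] {w v : Word}
    (hw : ∀ a ∈ w, p a) (hv : ∀ a ∈ v, ¬ p a) (m : ℕ+ →₀ ℕ) :
    MvPowerSeries.coeff m (fundamentalOfWord w * fundamentalOfWord v) =
      {R : Biword ℕ+ ℕ+ | topRow R = Finsupp.toMultiset m ∧
        (bottomRow R).filter (p ·) = w ∧ (bottomRow R).filter (¬ p ·) = v}.ncard := by
  classical
  simp only [MvPowerSeries.coeff_mul, coeff_fundamentalOfWord, ite_zero_mul_ite_zero, one_mul]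
  rw [Finset.sum_boole, ← Set.ncard_coe_finset, Nat.cast_inj]
  set 𝓡 := {R : Biword ℕ+ ℕ+ | topRow R = Finsupp.toMultiset m ∧
    (bottomRow R).filter (p ·) = w ∧ (bottomRow R).filter (¬ p ·) = v}
  let exponents (R : Biword ℕ+ ℕ+) : (ℕ+ →₀ ℕ) × (ℕ+ →₀ ℕ) :=
    ((topRow (restrict p R)).toFinsupp, (topRow (restrict (¬ p ·) R)).toFinsupp)
  have exponents_add (R) : (exponents R).1 + (exponents R).2 = (topRow R).toFinsupp := by
    rw [← map_add, ← topRow_add, restrict_add_restrict_not]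
  have hinj : Set.InjOn exponents 𝓡 := by
    rintro R ⟨-, hRw, hRv⟩ R' ⟨-, hRw', hRv'⟩ h
    obtain ⟨hlow, hhigh⟩ := Prod.mk.inj h
    rw [← restrict_add_restrict_not p R, ← restrict_add_restrict_not p R',
      eq_of_rows_eq (Multiset.toFinsupp.injective hlow)
        (by rw [bottomRow_restrict, bottomRow_restrict, hRw, hRw']),
      eq_of_rows_eq (Multiset.toFinsupp.injective hhigh)
        (by rw [bottomRow_restrict, bottomRow_restrict, hRv, hRv'])]
  rw [← hinj.ncard_image]
  congr 1
  ext ⟨a, b⟩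
  simp only [Finset.coe_filter, Finset.HasAntidiagonal.mem_antidiagonal, Set.mem_ofPred_eq,
    Set.mem_image, exists_rows_and_exists_rows_iff p hw hv, 𝓡]
  simp only [← Multiset.toFinsupp_eq_iff]
  constructor
  · rintro ⟨rfl, R, ⟨rfl, rfl⟩, hR⟩
    exact ⟨R, ⟨(exponents_add R).symm, hR⟩, rfl⟩
  · rintro ⟨R, ⟨hm, hR⟩, hab⟩
    obtain ⟨rfl, rfl⟩ := Prod.mk.inj hab
    exact ⟨(exponents_add R).trans hm, R, ⟨rfl, rfl⟩, hR⟩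

theorem fundamentalOfWord_mul_of_disjoint (p : ℕ+ → Prop) {w v : Word} (hw : ∀ a ∈ w, p a)
    (hv : ∀ a ∈ v, ¬ p a) :
    fundamentalOfWord w * fundamentalOfWord v =
      ((Word.shuffle w v).map fundamentalOfWord).sum := by
  classical
  ext m
  have hsum : ((Word.shuffle w v).map fundamentalOfWord).sum =
      ∑ u ∈ ⟨Word.shuffle w v, Word.nodup_shuffle_of_disjoint p hw hv⟩, fundamentalOfWord u := rfl
  rw [hsum, map_sum, sum_coeff_fundamentalOfWord, coeff_fundamentalOfWord_mul p hw hv]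
  simp only [Finset.mem_mk, Word.mem_shuffle_of_disjoint p hw hv]

end Biword

namespace WordSeries

open Word MvPowerSeries

/-- The extension of `w ↦ f_{D(w)}` to formal sums of words, coefficient by coefficient. A series
of unbounded letters may have infinitely many contributions to a coefficient, which is then `0` by
the convention for `∑ᶠ`. -/
noncomputable def fundamentalSum (F : WordSeries) : MvPowerSeries ℕ+ ℝ :=
  fun m => ∑ᶠ w, F w * coeff m (fundamentalOfWord w)

theorem coeff_fundamentalSum (F : WordSeries) (m : ℕ+ →₀ ℕ) :
    coeff m (fundamentalSum F) = ∑ᶠ w, F w * coeff m (fundamentalOfWord w) :=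
  rfl

theorem fundamentalSum_mem_QSym (F : WordSeries) : fundamentalSum F ∈ QSym := fun k i j a =>
  finsum_congr fun w => congrArg (F w * ·) (isQuasisymmetric_fundamental _ _ k i j a)

theorem support_mul_coeff_subset_boundedWords {F : WordSeries} {N L : ℕ}
    (hF : ∀ w, F w ≠ 0 → maxLetter w ≤ N) {m : ℕ+ →₀ ℕ} (hm : (Finsupp.toMultiset m).card ≤ L) :
    (Function.support fun w => F w * coeff m (fundamentalOfWord w)) ⊆ boundedWords L N :=
  fun w hw => ⟨(Biword.length_eq_card_of_coeff_fundamentalOfWord_ne_zero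
    (right_ne_zero_of_mul hw)).trans_le hm, hF w (left_ne_zero_of_mul hw)⟩

theorem finite_support_mul_coeff {F : WordSeries} (hF : F ∈ boundedLetters) (m : ℕ+ →₀ ℕ) :
    (Function.support fun w => F w * coeff m (fundamentalOfWord w)).Finite := by
  obtain ⟨N, hN⟩ := hF
  exact (boundedWords_finite _ N).subset (support_mul_coeff_subset_boundedWords hN le_rfl)

theorem coeff_fundamentalSum_eq_sum {F : WordSeries} {N L : ℕ}
    (hF : ∀ w, F w ≠ 0 → maxLetter w ≤ N) {m : ℕ+ →₀ ℕ} (hm : (Finsupp.toMultiset m).card ≤ L) :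
    coeff m (fundamentalSum F) =
      ∑ w ∈ (boundedWords_finite L N).toFinset, F w * coeff m (fundamentalOfWord w) :=
  finsum_eq_sum_of_support_subset _
    (by simpa using support_mul_coeff_subset_boundedWords hF hm)

theorem fundamentalSum_add {F G : WordSeries} (hF : F ∈ boundedLetters) (hG : G ∈ boundedLetters) :
    fundamentalSum (F + G) = fundamentalSum F + fundamentalSum G := by
  ext m
  simp only [map_add, coeff_fundamentalSum, add_apply, add_mul]
  exact finsum_add_distrib (finite_support_mul_coeff hF m) (finite_support_mul_coeff hG m)

theorem fundamentalSum_smul (r : ℝ) (F : WordSeries) :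
    fundamentalSum (r • F) = r • fundamentalSum F := by
  ext m
  simp only [map_smul, coeff_fundamentalSum, smul_apply, mul_assoc, smul_eq_mul, mul_finsum]

theorem coeff_fundamentalOfWord_mul_eq_sum (w w' : Word) (m : ℕ+ →₀ ℕ) {S : Finset Word}
    (hS : ∀ u, shuffleCoeff w w' u ≠ 0 → u.length = (Finsupp.toMultiset m).card → u ∈ S) :
    coeff m (fundamentalOfWord w * fundamentalOfWord w') =
      ∑ u ∈ S, (shuffleCoeff w w' u : ℝ) * coeff m (fundamentalOfWord u) := by
  rw [← fundamentalOfWord_shift (maxLetter w) w', Biword.fundamentalOfWord_mul_of_disjoint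
    (fun a => (a : ℕ) ≤ maxLetter w) ((maxLetter_le_iff w _).1 le_rfl)
    fun _ ha => not_le.2 (lt_of_mem_shift ha), Finset.sum_multiset_map_count, map_sum]
  simp_rw [map_nsmul, nsmul_eq_mul]
  refine Finset.sum_congr_of_eq_on_inter (fun u hu hnot => ?_) (fun u _ hnot => ?_) fun _ _ _ => rfl
  · by_contra h0
    exact hnot (hS u (Multiset.count_ne_zero.2 (Multiset.mem_toFinset.1 hu))
      (Biword.length_eq_card_of_coeff_fundamentalOfWord_ne_zero (right_ne_zero_of_mul h0)))
  · rw [shuffleCoeff, Multiset.count_eq_zero.2 (mt Multiset.mem_toFinset.2 hnot), Nat.cast_zero,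
      zero_mul]

theorem coeff_fundamentalSum_mul_fundamentalSum {F G : WordSeries} {N : ℕ}
    (hF : ∀ w, F w ≠ 0 → maxLetter w ≤ N) (hG : ∀ w, G w ≠ 0 → maxLetter w ≤ N) (m : ℕ+ →₀ ℕ) :
    coeff m (fundamentalSum F * fundamentalSum G) =
      ∑ w ∈ (boundedWords_finite (Finsupp.toMultiset m).card N).toFinset,
        ∑ w' ∈ (boundedWords_finite (Finsupp.toMultiset m).card N).toFinset,
          F w * G w' * coeff m (fundamentalOfWord w * fundamentalOfWord w') := by
  set S := (boundedWords_finite (Finsupp.toMultiset m).card N).toFinset with hS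
  have truncate {H : WordSeries} (hH : ∀ w, H w ≠ 0 → maxLetter w ≤ N) {a : ℕ+ →₀ ℕ}
      (ha : (Finsupp.toMultiset a).card ≤ (Finsupp.toMultiset m).card) :
      coeff a (fundamentalSum H) = coeff a (∑ w ∈ S, H w • fundamentalOfWord w) := by
    simp only [coeff_fundamentalSum_eq_sum hH ha, map_sum, map_smul, smul_eq_mul, hS]
  have hFG : coeff m (fundamentalSum F * fundamentalSum G) =
      coeff m ((∑ w ∈ S, F w • fundamentalOfWord w) * ∑ w' ∈ S, G w' • fundamentalOfWord w') := by
    rw [coeff_mul, coeff_mul]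
    refine Finset.sum_congr rfl fun p hp => ?_
    obtain rfl := Finset.HasAntidiagonal.mem_antidiagonal.1 hp
    rw [truncate hF (by simp), truncate hG (by simp)]
  simp only [hFG, Finset.sum_mul_sum, map_sum, smul_mul_smul_comm, map_smul, smul_eq_mul]

theorem fundamentalSum_mul {F G : WordSeries} (hF : F ∈ boundedLetters) (hG : G ∈ boundedLetters) :
    fundamentalSum (F * G) = fundamentalSum F * fundamentalSum G := by
  obtain ⟨N, hN⟩ := hF
  obtain ⟨N', hN'⟩ := hG
  ext m
  let S := (boundedWords_finite (Finsupp.toMultiset m).card (N + N')).toFinset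
  have hpair (w w' : Word) : F w * G w' * coeff m (fundamentalOfWord w * fundamentalOfWord w') =
      ∑ u ∈ S, F w * G w' * (shuffleCoeff w w' u * coeff m (fundamentalOfWord u)) := by
    by_cases h0 : F w * G w' = 0
    · simp [h0]
    rw [coeff_fundamentalOfWord_mul_eq_sum w w' m fun u hu hlength => ?_, Finset.mul_sum]
    have hmax := maxLetter_eq_add_of_shuffleCoeff_ne_zero hu
    have hw := hN w (left_ne_zero_of_mul h0)
    have hw' := hN' w' (right_ne_zero_of_mul h0)
    exact (Set.Finite.mem_toFinset _).2 ⟨hlength.le, by lia⟩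
  calc coeff m (fundamentalSum (F * G))
      = ∑ u ∈ S, (∑ w ∈ S, ∑ w' ∈ S, F w * G w' * shuffleCoeff w w' u) *
          coeff m (fundamentalOfWord u) := by
        rw [coeff_fundamentalSum_eq_sum
          (fun u => maxLetter_le_add_of_mul_apply_ne_zero hN hN') le_rfl]
        exact Finset.sum_congr rfl fun u hu => by
          rw [mul_apply_eq_sum F G ((Set.Finite.mem_toFinset _).1 hu)]
    _ = ∑ w ∈ S, ∑ w' ∈ S, ∑ u ∈ S,
          F w * G w' * (shuffleCoeff w w' u * coeff m (fundamentalOfWord u)) := by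
        simp only [Finset.sum_mul, mul_assoc]
        rw [Finset.sum_comm]
        exact Finset.sum_congr rfl fun w _ => Finset.sum_comm
    _ = coeff m (fundamentalSum F * fundamentalSum G) := by
        rw [coeff_fundamentalSum_mul_fundamentalSum
          (fun w hw => (hN w hw).trans (Nat.le_add_right _ _))
          (fun w hw => (hN' w hw).trans (Nat.le_add_left _ _))]
        simp only [hpair, S]

/-- The algebra homomorphism `F ↦ ∑ F(w) f_{D(w)}` on the word series of bounded letters. -/
noncomputable def fundamentalHom : boundedLetters →ₙₐ[ℝ] QSym where
  toFun F := ⟨fundamentalSum F, fundamentalSum_mem_QSym F⟩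
  map_smul' r F := Subtype.ext (fundamentalSum_smul r F)
  map_zero' := Subtype.ext <| by
    simpa using fundamentalSum_smul 0 0
  map_add' F G := Subtype.ext (fundamentalSum_add F.2 G.2)
  map_mul' F G := Subtype.ext (fundamentalSum_mul F.2 G.2)

theorem hasFormalSum_wordClass (h : Word) :
    HasFormalSum (fun w : {w // WeakKKnuth h w} => fundamentalOfWord w)
      (fundamentalSum (wordClass h)) := by
  classical
  intro m
  have hterm (w : Word) : wordClass h w * coeff m (fundamentalOfWord w) =
      if WeakKKnuth h w then coeff m (fundamentalOfWord w) else 0 := by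
    rw [wordClass, ite_mul, one_mul, zero_mul]
  constructor
  · have hfinite := finite_support_mul_coeff (wordClass_mem_boundedLetters h) m
    refine (hfinite.preimage Subtype.val_injective.injOn).subset fun w hw => ?_
    simpa [hterm, w.2] using hw
  · rw [coeff_fundamentalSum,
      finsum_subtype_eq_finsum_cond (f := fun w => coeff m (fundamentalOfWord w)) (WeakKKnuth h)]
    exact finsum_congr fun w => by rw [hterm, finsum_eq_if]

end WordSeries

theorem HasFormalSum.unique {ι : Type*} {f : ι → MvPowerSeries ℕ+ ℝ} {F G : MvPowerSeries ℕ+ ℝ}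
    (hF : HasFormalSum f F) (hG : HasFormalSum f G) : F = G :=
  MvPowerSeries.ext fun m => (hF m).2.trans (hG m).2.symm

theorem mainTheorem10 :
    ∃ A : NonUnitalSubalgebra ℝ WordSeries, A.toSubmodule = SKPR ∧
      ∃ φ : A →ₙₐ[ℝ] QSym,
        (∀ (h : Word) (x : A), Word.IsInitial h → (x : WordSeries) = WordSeries.wordClass h →
          HasFormalSum (fun w : {w : Word // Word.WeakKKnuth h w} => fundamentalOfWord w)
            (φ x : MvPowerSeries ℕ+ ℝ)) ∧
        ∀ ψ : A →ₗ[ℝ] QSym,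
          (∀ (h : Word) (x : A), Word.IsInitial h → (x : WordSeries) = WordSeries.wordClass h →
            HasFormalSum (fun w : {w : Word // Word.WeakKKnuth h w} => fundamentalOfWord w)
              (ψ x : MvPowerSeries ℕ+ ℝ)) →
          ∀ x : A, ψ x = φ x := by
  let A : NonUnitalSubalgebra ℝ WordSeries := { SKPR with mul_mem' := WordSeries.mul_mem_SKPR }
  let φ : A →ₙₐ[ℝ] QSym :=
    WordSeries.fundamentalHom.comp (NonUnitalSubalgebra.inclusion WordSeries.SKPR_le_boundedLetters)
  have formalSum_φ (h : Word) (x : A) (hx : (x : WordSeries) = WordSeries.wordClass h) :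
      HasFormalSum (fun w : {w : Word // Word.WeakKKnuth h w} => fundamentalOfWord w) (φ x) := by
    have hφ : (φ x : MvPowerSeries ℕ+ ℝ) = WordSeries.fundamentalSum x := rfl
    rw [hφ, hx]
    exact WordSeries.hasFormalSum_wordClass h
  refine ⟨A, rfl, φ, fun h x _ => formalSum_φ h x, fun ψ hψ x => ?_⟩
  have hext : ψ = (φ : A →ₗ[ℝ] QSym) := by
    refine (Submodule.linearMap_eq_iff_of_eq_span (V := SKPR) ψ φ rfl).2 ?_
    rintro ⟨_, h, hh, rfl⟩
    exact Subtype.ext ((hψ h _ hh rfl).unique (formalSum_φ h _ rfl))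
  exact congrArg (· x) hext
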